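/- **Notation.** Let $n\in\mathbb N$, $\langle z\rangle=(1+|z|^2)^{1/2}$ and $\text{đ}\xi=(2\pi)^{-n}d\xi$. All nets are indexed by $\epsilon\in(0,1]$. - $\mathcal E_\tau(\mathbb R^n)$ is the set of nets $(u_\epsilon)_\epsilon$ of smooth functions $u_\epsilon:\mathbb R^n\to\mathbb C$ such that for every $\alpha\in\mathbb N^n$ there is $N\in\mathbb N$ with $\sup_{\epsilon}\epsilon^{N}\|\langle x\rangle^{-N}\partial^\alpha u_\epsilon\|_{L^\infty}<\infty$. - $\mathcal N_{\mathcal S}(\mathbb R^n)$ is the set of nets of smooth functions with $\sup_\epsilon\epsilon^{-q}\|x^\alpha\partial^\beta u_\epsilon\|_{L^\infty}<\infty$ for all $\alpha,\beta\in\mathbb N^n$, $q\in\mathbb N$. - $\mathcal G_{\tau,\mathcal S}(\mathbb R^n)=\mathcal E_\tau(\mathbb R^n)/\mathcal N_{\mathcal S}(\mathbb R^n)$. - A mollifier is a function $\varphi\in\mathcal S(\mathbb R^n)$ with $\int\varphi=1$ and $\int x^\alpha\varphi(x)\,dx=0$ for all $\alpha\ne0$. Put $\varphi_\epsilon(x)=\epsilon^{-n}\varphi(x/\epsilon)$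 and $\widehat f(\xi)=\int e^{-ix\xi}f(x)\,dx$. - A weight function is a continuous $\Lambda:\mathbb R^{2n}\to\mathbb R$ for which there are $\mu>0$ and constants such that (i) $\langle z\rangle^\mu\prec\Lambda(z)\prec\langle z\rangle$; (ii) $\Lambda(z)\prec\Lambda(\zeta)\prec\Lambda(z)$ whenever $|\zeta-z|\le\mu\Lambda(z)$; (iii) for every $t\in\mathbb R^{2n}$, $\Lambda(t_1z_1,\dots,t_{2n}z_{2n})\prec\Lambda(z)$. Here $f\prec g$ means $f\le cg$ with a constant $c>0$ independent of the points $z,\zeta$ (in (iii) it may depend on $t$). - For $m\in\mathbb R$ and $\rho\in(0,1]$, $\overline{\mathcal S}^m_{\Lambda,\rho}$ is the set of nets $(a_\epsilon)_\epsilon$ of smooth functions $a_\epsilon(x,y,\xi)$ on $\mathbb R^{3n}$ for which there is $m'\in\mathbb R$ such that for all $\alpha,\beta,\gamma\in\mathbb N^n$ there are $N\in\mathbb N$, $c>0$ with $$|\partial^\alpha_\xi\partial^\beta_x\partial^\gamma_y a_\epsilon(x,y,\xi)|\le c\,\Lambda(x,\xi)^m\langle x-y\rangle^{m'}\bigl(1+\Lambda(x,\xi)\langle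 x-y\rangle^{-m'}\bigr)^{-\rho|\alpha+\beta+\gamma|}\epsilon^{-N}$$ for all $\epsilon\in(0,1]$ and $(x,y,\xi)\in\mathbb R^{3n}$. The set $\overline{\mathcal N}^m_{\Lambda,\rho}$ of negligible amplitudes consists of those $(a_\epsilon)_\epsilon\in\overline{\mathcal S}^m_{\Lambda,\rho}$ for which there is $m'\in\mathbb R$ such that for all $\alpha,\beta,\gamma\in\mathbb N^n$ and all $q\in\mathbb N$ this estimate holds for some $c>0$ with $\epsilon^{q}$ in place of $\epsilon^{-N}$. - The oscillatory integral $\int e^{i\omega(z)}b(z)\,dz$ is the limit of the absolutely convergent integrals $\int e^{i\omega(z)}b(z)\psi(hz)\,dz$ as $h\to0^+$, if it exists and is the same for every Schwartz function $\psi$ with $\psi(0)=1$. **Theorem 5.1.** Let $\varphi$ be a mollifier, $\Lambda$ a weight function, $m\in\mathbb R$, $\rho\in(0,1]$ and $(a_\epsilon)_\epsilon\in\overline{\mathcal S}^m_{\Lambda,\rho}$. For every $(u_\epsilon)_\epsilon\in\mathcal E_\tau(\mathbb R^n)$, $\epsilon\in(0,1]$ and $x\in\mathbb R^n$ the oscillatory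 integral $$A_\epsilon u_\epsilon(x)=\int_{\mathbb R^{2n}}e^{i(x-y)\xi}a_\epsilon(x,y,\xi)u_\epsilon(y)\widehat{\varphi_\epsilon}(y)\,dy\,\text{đ}\xi ,$$ with phase $-y\xi$ in the variables $(y,\xi)$, exists, and 1. $(u_\epsilon)_\epsilon\in\mathcal E_\tau(\mathbb R^n)$ implies $(A_\epsilon u_\epsilon)_\epsilon\in\mathcal E_\tau(\mathbb R^n)$; 2. $(u_\epsilon)_\epsilon\in\mathcal N_{\mathcal S}(\mathbb R^n)$ implies $(A_\epsilon u_\epsilon)_\epsilon\in\mathcal N_{\mathcal S}(\mathbb R^n)$; 3. if $(a_\epsilon)_\epsilon\in\overline{\mathcal N}^m_{\Lambda,\rho}$, then $(u_\epsilon)_\epsilon\in\mathcal E_\tau(\mathbb R^n)$ implies $(A_\epsilon u_\epsilon)_\epsilon\in\mathcal N_{\mathcal S}(\mathbb R^n)$. Hence there is exactly one linear map $A:\mathcal G_{\tau,\mathcal S}(\mathbb R^n)\to\mathcal G_{\tau,\mathcal S}(\mathbb R^n)$ sending the class of each $(u_\epsilon)_\epsilon\in\mathcal E_\tau(\mathbb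 R^n)$ to the class of $(A_\epsilon u_\epsilon)_\epsilon$. -/

import Mathlib

namespace Colombeau

noncomputable section

/-- `ℝⁿ` with its Euclidean norm. -/
abbrev Rn (n : ℕ) : Type := EuclideanSpace ℝ (Fin n)

/-- `ℝ²ⁿ = ℝⁿ × ℝⁿ` with its Euclidean norm; its points are `WithLp.toLp 2 (x, ξ)`. -/
abbrev R2n (n : ℕ) : Type := WithLp 2 (Rn n × Rn n)

/-- The parameter set `(0, 1]`. -/
abbrev Param : Type := Set.Ioc (0 : ℝ) 1

/-- Nets `(u_ε)_ε`, `ε ∈ (0, 1]`, of complex functions on `V`. -/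
abbrev Net (V : Type) : Type := Param → V → ℂ

/-- `⟨x⟩ = (1 + |x|²)^(1/2)`. -/
def japanese {V : Type} [NormedAddCommGroup V] (x : V) : ℝ :=
  Real.sqrt (1 + ‖x‖ ^ 2)

/-- The length `|α| = ∑ i, α i` of a multi-index. -/
abbrev order {n : ℕ} (α : Fin n → ℕ) : ℕ := ∑ i, α i

/-- The monomial `x ^ α`. -/
def monomial {n : ℕ} (α : Fin n → ℕ) (x : Rn n) : ℝ := ∏ i, x i ^ α i

/-- The list of coordinate vectors `e₁, …, e₁, e₂, …, e₂, …` of length `|α|`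
in which `e_i` occurs `α i` times. -/
def directions {n : ℕ} (α : Fin n → ℕ) : Fin (order α) → Rn n :=
  fun j => EuclideanSpace.single (finSigmaFinEquiv.symm j).1 1

/-- The partial derivative `∂^α f (x)`: the iterated Fréchet derivative of order `|α|`
evaluated at the coordinate vectors prescribed by `α` (used for smooth `f` only). -/
def partialD {n : ℕ} (α : Fin n → ℕ) (f : Rn n → ℂ) (x : Rn n) : ℂ :=
  iteratedFDeriv ℝ (order α) f x (directions α)

/-- The mixed partial derivative `∂_ξ^α ∂_x^β ∂_y^γ f (x, y, ξ)`. -/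
def partialD₃ {n : ℕ} (α β γ : Fin n → ℕ) (f : Rn n × Rn n × Rn n → ℂ)
    (p : Rn n × Rn n × Rn n) : ℂ :=
  iteratedFDeriv ℝ (order α + order β + order γ) f p
    (Fin.append
      (Fin.append (fun j => (0, 0, directions α j)) (fun j => (directions β j, 0, 0)))
      (fun j => (0, directions γ j, 0)))

theorem partialD_zero {n : ℕ} (α : Fin n → ℕ) (x : Rn n) :
    partialD α (0 : Rn n → ℂ) x = 0 := by
  rw [partialD, show ((0 : Rn n → ℂ)) = fun _ => (0 : ℂ) from rfl, iteratedFDeriv_fun_zero]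
  rfl

theorem partialD_add {n : ℕ} (α : Fin n → ℕ) {f g : Rn n → ℂ} (hf : ContDiff ℝ (⊤ : ℕ∞) f)
    (hg : ContDiff ℝ (⊤ : ℕ∞) g) (x : Rn n) :
    partialD α (f + g) x = partialD α f x + partialD α g x := by
  have h := iteratedFDeriv_add (𝕜 := ℝ) (i := order α)
    (hf.of_le (by exact_mod_cast le_top)) (hg.of_le (by exact_mod_cast le_top))
  rw [partialD, h]
  rfl

theorem partialD_smul {n : ℕ} (α : Fin n → ℕ) {f : Rn n → ℂ} (hf : ContDiff ℝ (⊤ : ℕ∞) f)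
    (c : ℂ) (x : Rn n) : partialD α (c • f) x = c * partialD α f x := by
  have hf' : ContDiff ℝ (order α) f := hf.of_le (by exact_mod_cast le_top)
  rw [partialD, iteratedFDeriv_const_smul_apply hf'.contDiffAt]
  rfl

/-! ### The spaces of nets and the factor space -/

/-- `ℰ_τ(ℝⁿ)`: nets of smooth functions such that for all `α` there is `N` with
`sup_ε ε^N ‖⟨x⟩^(-N) ∂^α u_ε‖_∞ < ∞`. -/
def ETau (n : ℕ) : Submodule ℂ (Net (Rn n)) where
  carrier := {u | (∀ ε, ContDiff ℝ (⊤ : ℕ∞) (u ε)) ∧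
    ∀ α : Fin n → ℕ, ∃ N : ℕ, ∃ C : ℝ, ∀ (ε : Param) (x : Rn n),
      (ε : ℝ) ^ N * ((japanese x ^ N)⁻¹ * ‖partialD α (u ε) x‖) ≤ C}
  zero_mem' := by
    refine ⟨fun ε => contDiff_const, fun α => ⟨0, 0, fun ε x => ?_⟩⟩
    have h := partialD_zero α x
    simp [h]
  add_mem' := by
    rintro u v ⟨hu, hu'⟩ ⟨hv, hv'⟩
    refine ⟨fun ε => (hu ε).add (hv ε), fun α => ?_⟩
    obtain ⟨N, C, hC⟩ := hu' α
    obtain ⟨M, D, hD⟩ := hv' α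
    refine ⟨N + M, C + D, fun ε x => ?_⟩
    have h : partialD α ((u + v) ε) x = partialD α (u ε) x + partialD α (v ε) x :=
      partialD_add _ (hu ε) (hv ε) x
    have hε0 : (0 : ℝ) < ε := ε.2.1
    have hε1 : (ε : ℝ) ≤ 1 := ε.2.2
    have hJ : 1 ≤ japanese x := by
      rw [japanese]; exact Real.one_le_sqrt.2 (by nlinarith [sq_nonneg ‖x‖])
    have key : ∀ (K L : ℕ) (t : ℝ), 0 ≤ t →
        (ε : ℝ) ^ (K + L) * ((japanese x ^ (K + L))⁻¹ * t) ≤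
          (ε : ℝ) ^ K * ((japanese x ^ K)⁻¹ * t) := by
      intro K L t ht
      have h1 : (ε : ℝ) ^ (K + L) ≤ (ε : ℝ) ^ K :=
        pow_le_pow_of_le_one hε0.le hε1 (Nat.le_add_right _ _)
      have h2 : (japanese x ^ (K + L))⁻¹ ≤ (japanese x ^ K)⁻¹ :=
        inv_anti₀ (by positivity) (pow_le_pow_right₀ hJ (Nat.le_add_right _ _))
      have h3 : 0 ≤ (japanese x ^ (K + L))⁻¹ := by positivity
      exact mul_le_mul h1 (mul_le_mul_of_nonneg_right h2 ht) (mul_nonneg h3 ht) (by positivity)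
    have k1 := key N M _ (norm_nonneg (partialD α (u ε) x))
    have k2 := key M N _ (norm_nonneg (partialD α (v ε) x))
    rw [add_comm M N] at k2
    have hpos : 0 ≤ (ε : ℝ) ^ (N + M) * (japanese x ^ (N + M))⁻¹ := by positivity
    have k3 := mul_le_mul_of_nonneg_left
      (norm_add_le (partialD α (u ε) x) (partialD α (v ε) x)) hpos
    rw [h]
    have := hC ε x
    have := hD ε x
    nlinarith
  smul_mem' := by
    rintro c u ⟨hu, hu'⟩
    refine ⟨fun ε => (hu ε).const_smul c, fun α => ?_⟩
    obtain ⟨N, C, hC⟩ := hu' α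
    refine ⟨N, ‖c‖ * C, fun ε x => ?_⟩
    have h : partialD α ((c • u) ε) x = c * partialD α (u ε) x :=
      partialD_smul _ (hu ε) c x
    rw [h, norm_mul]
    have := mul_le_mul_of_nonneg_left (hC ε x) (norm_nonneg c)
    nlinarith

/-- `𝒩_𝒮(ℝⁿ)`: nets of smooth functions such that for all `α`, `β` and `q`,
`sup_ε ε^(-q) ‖x^α ∂^β u_ε‖_∞ < ∞`. -/
def NS (n : ℕ) : Submodule ℂ (Net (Rn n)) where
  carrier := {u | (∀ ε, ContDiff ℝ (⊤ : ℕ∞) (u ε)) ∧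
    ∀ (α β : Fin n → ℕ) (q : ℕ), ∃ C : ℝ, ∀ (ε : Param) (x : Rn n),
      ((ε : ℝ) ^ q)⁻¹ * ‖(monomial α x : ℂ) * partialD β (u ε) x‖ ≤ C}
  zero_mem' := by
    refine ⟨fun ε => contDiff_const, fun α β q => ⟨0, fun ε x => ?_⟩⟩
    have h := partialD_zero β x
    simp [h]
  add_mem' := by
    rintro u v ⟨hu, hu'⟩ ⟨hv, hv'⟩
    refine ⟨fun ε => (hu ε).add (hv ε), fun α β q => ?_⟩
    obtain ⟨C, hC⟩ := hu' α β q
    obtain ⟨D, hD⟩ := hv' α β q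
    refine ⟨C + D, fun ε x => ?_⟩
    have h : partialD β ((u + v) ε) x = partialD β (u ε) x + partialD β (v ε) x :=
      partialD_add _ (hu ε) (hv ε) x
    have hpos : 0 ≤ ((ε : ℝ) ^ q)⁻¹ := inv_nonneg.2 (pow_nonneg ε.2.1.le _)
    rw [h, mul_add]
    have k := mul_le_mul_of_nonneg_left (norm_add_le
      ((monomial α x : ℂ) * partialD β (u ε) x) ((monomial α x : ℂ) * partialD β (v ε) x)) hpos
    have := hC ε x
    have := hD ε x
    linarith
  smul_mem' := by
    rintro c u ⟨hu, hu'⟩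
    refine ⟨fun ε => (hu ε).const_smul c, fun α β q => ?_⟩
    obtain ⟨C, hC⟩ := hu' α β q
    refine ⟨‖c‖ * C, fun ε x => ?_⟩
    have h : partialD β ((c • u) ε) x = c * partialD β (u ε) x :=
      partialD_smul _ (hu ε) c x
    rw [h, mul_left_comm, norm_mul]
    have := mul_le_mul_of_nonneg_left (hC ε x) (norm_nonneg c)
    linarith

/-- The factor space `𝒢_{τ,𝒮}(ℝⁿ) = ℰ_τ(ℝⁿ) / 𝒩_𝒮(ℝⁿ)`. -/
abbrev GTauS (n : ℕ) : Type := ETau n ⧸ (NS n).submoduleOf (ETau n)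

/-- The class in `𝒢_{τ,𝒮}(ℝⁿ)` of a net in `ℰ_τ(ℝⁿ)`. -/
abbrev GTauS.mk {n : ℕ} (u : ETau n) : GTauS n := Submodule.Quotient.mk u

/-! ### Mollifiers -/

/-- A Schwartz function with integral one all of whose higher moments vanish. -/
def IsMollifier {n : ℕ} (φ : SchwartzMap (Rn n) ℂ) : Prop :=
  ∫ x, φ x = 1 ∧ ∀ α : Fin n → ℕ, α ≠ 0 → ∫ x, (monomial α x : ℂ) * φ x = 0

/-- `φ_ε(x) = ε^(-n) φ(x / ε)`. -/
def scaled {n : ℕ} (φ : SchwartzMap (Rn n) ℂ) (ε : Param) (x : Rn n) : ℂ :=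
  (((ε : ℝ) ^ n)⁻¹ : ℝ) * φ ((ε : ℝ)⁻¹ • x)

/-- The Fourier transform `f̂(ξ) = ∫ e^{-i x ξ} f(x) dx`. -/
def hat {n : ℕ} (f : Rn n → ℂ) (ξ : Rn n) : ℂ :=
  ∫ x, Complex.exp (-Complex.I * (inner ℝ x ξ : ℝ)) * f x

/-! ### Weight functions and amplitudes -/

/-- Weight functions on `ℝ²ⁿ`. -/
structure IsWeight {n : ℕ} (Λ : R2n n → ℝ) : Prop where
  continuous : Continuous Λ
  /-- Conditions i) and ii), with the same `μ`:
  `⟨z⟩^μ ≺ Λ(z) ≺ ⟨z⟩`, and `Λ(z) ∼ Λ(ζ)` for `|ζ - z| ≤ μ Λ(z)`. -/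
  bounds : ∃ μ > (0 : ℝ),
    (∃ c > (0 : ℝ), ∀ z, japanese z ^ μ ≤ c * Λ z) ∧
    (∃ c > (0 : ℝ), ∀ z, Λ z ≤ c * japanese z) ∧
    (∃ c > (0 : ℝ), ∀ z ζ, ‖ζ - z‖ ≤ μ * Λ z → Λ z ≤ c * Λ ζ) ∧
    (∃ c > (0 : ℝ), ∀ z ζ, ‖ζ - z‖ ≤ μ * Λ z → Λ ζ ≤ c * Λ z)
  /-- Condition iii): `Λ(tz) ≺ Λ(z)` for every `t = (s, r)` in `ℝ²ⁿ`, where `tz` is the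
  coordinatewise product. -/
  scaling : ∀ s r : Fin n → ℝ, ∃ c > (0 : ℝ), ∀ x ξ : Rn n,
    Λ (WithLp.toLp 2 (WithLp.toLp 2 (fun i => s i * x i), WithLp.toLp 2 (fun i => r i * ξ i))) ≤
      c * Λ (WithLp.toLp 2 (x, ξ))

/-- `Λ(x,ξ)^m ⟨x-y⟩^{m'} (1 + Λ(x,ξ) ⟨x-y⟩^{-m'})^{-ρ k}`, where `k = |α + β + γ|`. -/
def amplitudeWeight {n : ℕ} (Λ : R2n n → ℝ) (ρ m m' : ℝ) (k : ℕ) (x y ξ : Rn n) : ℝ :=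
  Λ (WithLp.toLp 2 (x, ξ)) ^ m * japanese (x - y) ^ m' *
    (1 + Λ (WithLp.toLp 2 (x, ξ)) * japanese (x - y) ^ (-m')) ^ (-(ρ * k))

/-- The amplitudes `S̄^m_{Λ,ρ}`; the exponent `m'` does not depend on the derivatives. -/
def Amplitude {n : ℕ} (Λ : R2n n → ℝ) (m ρ : ℝ) : Set (Net (Rn n × Rn n × Rn n)) :=
  {a | (∀ ε, ContDiff ℝ (⊤ : ℕ∞) (a ε)) ∧
    ∃ m' : ℝ, ∀ α β γ : Fin n → ℕ, ∃ N : ℕ, ∃ c > (0 : ℝ), ∀ (ε : Param) (x y ξ : Rn n),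
      ‖partialD₃ α β γ (a ε) (x, y, ξ)‖ ≤
        c * amplitudeWeight Λ ρ m m' (order (α + β + γ)) x y ξ * ((ε : ℝ) ^ N)⁻¹}

/-- The negligible amplitudes `N̄^m_{Λ,ρ}`. -/
def NegligibleAmplitude {n : ℕ} (Λ : R2n n → ℝ) (m ρ : ℝ) : Set (Net (Rn n × Rn n × Rn n)) :=
  {a | a ∈ Amplitude Λ m ρ ∧
    ∃ m' : ℝ, ∀ (α β γ : Fin n → ℕ) (q : ℕ), ∃ c > (0 : ℝ), ∀ (ε : Param) (x y ξ : Rn n),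
      ‖partialD₃ α β γ (a ε) (x, y, ξ)‖ ≤
        c * amplitudeWeight Λ ρ m m' (order (α + β + γ)) x y ξ * (ε : ℝ) ^ q}

/-! ### Oscillatory integrals and the operator -/

/-- The oscillatory integral `∫ e^{i ω(z)} b(z) dz` exists and equals `I`: for every Schwartz
function `ψ` with `ψ(0) = 1` the regularized integrals `∫ e^{i ω(z)} b(z) ψ(hz) dz` converge
absolutely and tend to `I` as `h → 0⁺`. A cutoff `ψ ∈ C_c^∞` along `h = 2^(-j)` is a
special case. -/
def IsOscIntegral {V : Type} [NormedAddCommGroup V] [NormedSpace ℝ V]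
    [MeasureTheory.MeasureSpace V] (ω : V → ℝ) (b : V → ℂ) (I : ℂ) : Prop :=
  ∀ ψ : SchwartzMap V ℂ, ψ 0 = 1 →
    (∀ h : ℝ, 0 < h →
      MeasureTheory.Integrable (fun z => Complex.exp (Complex.I * ω z) * b z * ψ (h • z))) ∧
    Filter.Tendsto (fun h : ℝ => ∫ z, Complex.exp (Complex.I * ω z) * b z * ψ (h • z))
      (nhdsWithin 0 (Set.Ioi 0)) (nhds I)

open Classical in
/-- The value of the oscillatory integral (`0` if it does not exist). -/
def oscIntegral {V : Type} [NormedAddCommGroup V] [NormedSpace ℝ V]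
    [MeasureTheory.MeasureSpace V] (ω : V → ℝ) (b : V → ℂ) : ℂ :=
  if h : ∃ I, IsOscIntegral ω b I then h.choose else 0

/-- The phase function `-yξ` of the variables `(y, ξ)`. -/
def phase {n : ℕ} (p : Rn n × Rn n) : ℝ := -inner ℝ p.1 p.2

/-- `b_ε(x, y, ξ) = e^{ixξ} a_ε(x,y,ξ) u_ε(y) φ̂_ε(y)` as a function of `(y, ξ)`. -/
def integrand {n : ℕ} (φ : SchwartzMap (Rn n) ℂ) (a : Net (Rn n × Rn n × Rn n))
    (u : Net (Rn n)) (ε : Param) (x : Rn n) (p : Rn n × Rn n) : ℂ :=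
  Complex.exp (Complex.I * (inner ℝ x p.2 : ℝ)) * a ε (x, p.1, p.2) * u ε p.1 *
    hat (scaled φ ε) p.1

/-- `A_ε u_ε(x) = ∫∫ e^{i(x-y)ξ} a_ε(x,y,ξ) u_ε(y) φ̂_ε(y) dy đξ` as an oscillatory integral
in `(y, ξ)`, with `đξ = (2π)^(-n) dξ`. -/
def psiDO {n : ℕ} (φ : SchwartzMap (Rn n) ℂ) (a : Net (Rn n × Rn n × Rn n))
    (u : Net (Rn n)) : Net (Rn n) :=
  fun ε x => (((2 * Real.pi) ^ n)⁻¹ : ℝ) * oscIntegral phase (integrand φ a u ε x)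

end

end Colombeau

open Colombeau

/-!
For `ε ∈ (0, 1]` the factor `φ̂_ε(y) = φ̂(ε y)` and its derivatives decay rapidly in `y` at the cost
of powers of `ε⁻¹`; as `a` and `u` grow polynomially, so does `b = a u φ̂_ε` with its derivatives.
Hence the inner integral `∫ e^{-i y ξ} b(x, y, ξ) dy` converges absolutely and, by integration by
parts, decays rapidly in `ξ`, and the outer integral is the inverse Fourier integral of a function
of `ξ`, which therefore decays rapidly in `x`. A cutoff `ψ(h ·)` passes through both integrals by
dominated convergence, so that the oscillatory integral is the iterated one.

Every bound is a product of a function of `ε` and a weight. The functions of `ε` involved are the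
elements of the spaces of moderate and of negligible functions, and the negligible ones form an
ideal of the moderate ones: one factor `a` or `u` with negligible bounds makes `A u` negligible.
-/

namespace Colombeau

open MeasureTheory Filter Topology Asymptotics
open scoped ContDiff FourierTransform RealInnerProductSpace

section WeightedBound

variable {ι E : Type*} {T T₁ T₂ : Submodule ℝ (ι → ℝ)} {W W₁ W₂ : E → ℝ} {X Y : ι → E → ℝ}

/-- The family `X` is bounded by the weight `W`, up to a factor which depends on the index only and
belongs to the space `T` of admissible dependences. For `T = 1`, the space of constants, the bound
is uniform in the index. -/
def WeightedBound (T : Submodule ℝ (ι → ℝ)) (W : E → ℝ) (X : ι → E → ℝ) : Prop :=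
  ∃ C ∈ T, 0 ≤ C ∧ ∀ i p, X i p ≤ C i * W p

namespace WeightedBound

theorem mono (hX : WeightedBound T W X) (h : ∀ i p, Y i p ≤ X i p) : WeightedBound T W Y :=
  let ⟨C, hC, hC0, hCX⟩ := hX
  ⟨C, hC, hC0, fun i p => (h i p).trans (hCX i p)⟩

theorem mono_space (hX : WeightedBound T₁ W X) (hT : T₁ ≤ T₂) : WeightedBound T₂ W X :=
  let ⟨C, hC, h⟩ := hX
  ⟨C, hT hC, h⟩

theorem mono_weight (hX : WeightedBound T W₁ X) {c : ℝ} (hc : 0 ≤ c)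
    (hW : ∀ p, W₁ p ≤ c * W₂ p) : WeightedBound T W₂ X := by
  obtain ⟨C, hC, hC0, h⟩ := hX
  refine ⟨c • C, T.smul_mem c hC, smul_nonneg hc hC0, fun i p => ?_⟩
  calc X i p ≤ C i * W₁ p := h i p
    _ ≤ C i * (c * W₂ p) := mul_le_mul_of_nonneg_left (hW p) (hC0 i)
    _ = (c • C) i * W₂ p := by simp only [Pi.smul_apply, smul_eq_mul]; ring

theorem comp {E' : Type*} (hX : WeightedBound T W X) (q : E' → E) :
    WeightedBound T (fun p => W (q p)) fun i p => X i (q p) :=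
  let ⟨C, hC, hC0, h⟩ := hX
  ⟨C, hC, hC0, fun i p => h i (q p)⟩

theorem const_mul (hX : WeightedBound T W X) {c : ℝ} (hc : 0 ≤ c) :
    WeightedBound T W fun i p => c * X i p := by
  obtain ⟨C, hC, hC0, h⟩ := hX
  refine ⟨c • C, T.smul_mem c hC, smul_nonneg hc hC0, fun i p => ?_⟩
  rw [Pi.smul_apply, smul_eq_mul, mul_assoc]
  exact mul_le_mul_of_nonneg_left (h i p) hc

theorem sum {κ : Type*} {s : Finset κ} {X : κ → ι → E → ℝ}
    (hX : ∀ j ∈ s, WeightedBound T W (X j)) : WeightedBound T W fun i p => ∑ j ∈ s, X j i p := by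
  choose! C hC hC0 h using hX
  refine ⟨∑ j ∈ s, C j, T.sum_mem hC, Finset.sum_nonneg hC0, fun i p => ?_⟩
  rw [Finset.sum_apply, Finset.sum_mul]
  exact Finset.sum_le_sum fun j hj => h j hj i p

theorem add (hX : WeightedBound T W X) (hY : WeightedBound T W Y) :
    WeightedBound T W fun i p => X i p + Y i p := by
  obtain ⟨C, hC, hC0, hCX⟩ := hX
  obtain ⟨D, hD, hD0, hDY⟩ := hY
  refine ⟨C + D, T.add_mem hC hD, add_nonneg hC0 hD0, fun i p => ?_⟩
  rw [Pi.add_apply, add_mul]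
  exact add_le_add (hCX i p) (hDY i p)

theorem mul (hX : WeightedBound T₁ W₁ X) (hY : WeightedBound T₂ W₂ Y) (hX0 : ∀ i p, 0 ≤ X i p)
    (hY0 : ∀ i p, 0 ≤ Y i p) :
    WeightedBound (T₁ * T₂) (fun p => W₁ p * W₂ p) fun i p => X i p * Y i p := by
  obtain ⟨C, hC, hC0, hCX⟩ := hX
  obtain ⟨D, hD, hD0, hDY⟩ := hY
  refine ⟨C * D, Submodule.mul_mem_mul hC hD, mul_nonneg hC0 hD0, fun i p => ?_⟩
  calc X i p * Y i p ≤ (C i * W₁ p) * (D i * W₂ p) :=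
        mul_le_mul (hCX i p) (hDY i p) (hY0 i p) ((hX0 i p).trans (hCX i p))
    _ = (C * D) i * (W₁ p * W₂ p) := mul_mul_mul_comm ..

end WeightedBound

theorem weightedBound_one {c : ℝ} (hc : 0 ≤ c) (h : ∀ i p, X i p ≤ c * W p) :
    WeightedBound 1 W X :=
  ⟨fun _ => c, Submodule.mem_one.2 ⟨c, rfl⟩, fun _ => hc, h⟩

end WeightedBound

section DerivBound

variable {ι E F G H : Type*} [NormedAddCommGroup E] [NormedSpace ℝ E]
  [NormedAddCommGroup F] [NormedSpace ℝ F] [NormedAddCommGroup G] [NormedSpace ℝ G]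
  [NormedAddCommGroup H] [NormedSpace ℝ H] {T T₁ T₂ : Submodule ℝ (ι → ℝ)} {W W₁ W₂ : E → ℝ}
  {f g : ι → E → F}

theorem norm_iteratedFDeriv_comp_clm_le {f : E → F} (hf : ContDiff ℝ ∞ f) (L : G →L[ℝ] E) (k : ℕ)
    (x : G) :
    ‖iteratedFDeriv ℝ k (fun y => f (L y)) x‖ ≤ ‖L‖ ^ k * ‖iteratedFDeriv ℝ k f (L x)‖ := by
  have h := L.iteratedFDeriv_comp_right hf x (i := k) (by exact_mod_cast le_top)
  rw [mul_comm, show (fun y => f (L y)) = f ∘ L from rfl, h]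
  exact (ContinuousMultilinearMap.norm_compContinuousLinearMap_le _ _).trans_eq (by simp)

/-- A family of smooth functions all of whose derivatives are bounded by the weight `W`, up to
factors in `T`. -/
def DerivBound (T : Submodule ℝ (ι → ℝ)) (W : E → ℝ) (f : ι → E → F) : Prop :=
  (∀ i, ContDiff ℝ ∞ (f i)) ∧ ∀ k : ℕ, WeightedBound T W fun i p => ‖iteratedFDeriv ℝ k (f i) p‖

namespace DerivBound

theorem norm (hf : DerivBound T W f) : WeightedBound T W fun i p => ‖f i p‖ := by
  simpa only [norm_iteratedFDeriv_zero] using hf.2 0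

theorem mono_space (hf : DerivBound T₁ W f) (hT : T₁ ≤ T₂) : DerivBound T₂ W f :=
  ⟨hf.1, fun k => (hf.2 k).mono_space hT⟩

theorem mono_weight (hf : DerivBound T W₁ f) {c : ℝ} (hc : 0 ≤ c) (hW : ∀ p, W₁ p ≤ c * W₂ p) :
    DerivBound T W₂ f :=
  ⟨hf.1, fun k => (hf.2 k).mono_weight hc hW⟩

theorem add (hf : DerivBound T W f) (hg : DerivBound T W g) :
    DerivBound T W fun i p => f i p + g i p := by
  refine ⟨fun i => (hf.1 i).add (hg.1 i), fun k => ((hf.2 k).add (hg.2 k)).mono fun i p => ?_⟩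
  have h := iteratedFDeriv_add_apply (𝕜 := ℝ) (i := k) (x := p)
    ((hf.1 i).contDiffAt.of_le (by exact_mod_cast le_top))
    ((hg.1 i).contDiffAt.of_le (by exact_mod_cast le_top))
  change ‖iteratedFDeriv ℝ k (f i + g i) p‖ ≤ _
  exact h ▸ norm_add_le _ _

theorem clm_comp (hf : DerivBound T W f) (L : F →L[ℝ] G) :
    DerivBound T W fun i p => L (f i p) :=
  ⟨fun i => L.contDiff.comp (hf.1 i), fun k => ((hf.2 k).const_mul (norm_nonneg L)).mono
    fun i _ => L.norm_iteratedFDeriv_comp_left (hf.1 i).contDiffAt (by exact_mod_cast le_top)⟩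

theorem comp_clm (hf : DerivBound T W f) (L : G →L[ℝ] E) :
    DerivBound T (fun q => W (L q)) fun i q => f i (L q) :=
  ⟨fun i => (hf.1 i).comp L.contDiff, fun k =>
    (((hf.2 k).comp L).const_mul (pow_nonneg (norm_nonneg L) k)).mono
      fun i => norm_iteratedFDeriv_comp_clm_le (hf.1 i) L k⟩

protected theorem fderiv (hf : DerivBound T W f) : DerivBound T W fun i => fderiv ℝ (f i) :=
  ⟨fun i => (hf.1 i).fderiv_right (by exact_mod_cast le_top), fun k => by
    simpa only [norm_iteratedFDeriv_fderiv] using hf.2 (k + 1)⟩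

theorem bilinear {g : ι → E → G} (hf : DerivBound T₁ W₁ f) (hg : DerivBound T₂ W₂ g)
    (B : F →L[ℝ] G →L[ℝ] H) :
    DerivBound (T₁ * T₂) (fun p => W₁ p * W₂ p) fun i p => B (f i p) (g i p) := by
  refine ⟨fun i => B.isBoundedBilinearMap.contDiff.comp ((hf.1 i).prodMk (hg.1 i)), fun k => ?_⟩
  refine WeightedBound.mono (.const_mul (.sum fun j _ =>
    (((hf.2 j).const_mul (Nat.cast_nonneg (k.choose j))).mul (hg.2 (k - j))
      (fun _ _ => by positivity) fun _ _ => norm_nonneg _)) (norm_nonneg B)) fun i p =>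
    B.norm_iteratedFDeriv_le_of_bilinear (hf.1 i) (hg.1 i) p (by exact_mod_cast le_top)

theorem const (hf : DerivBound T W f) (i : ι) {κ : Type*} :
    DerivBound (1 : Submodule ℝ (κ → ℝ)) W fun _ => f i :=
  ⟨fun _ => hf.1 i, fun k =>
    let ⟨_, _, hC0, hC⟩ := hf.2 k
    weightedBound_one (hC0 i) fun _ => hC i⟩

end DerivBound

theorem derivBound_clm (L : E →L[ℝ] F) :
    DerivBound (1 : Submodule ℝ (ι → ℝ)) (fun p => 1 + ‖p‖) fun _ p => L p := by
  refine ⟨fun _ => L.contDiff, fun k => weightedBound_one (norm_nonneg L) fun _ p => ?_⟩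
  match k with
  | 0 =>
    rw [norm_iteratedFDeriv_zero]
    exact (L.le_opNorm p).trans (by gcongr; linarith)
  | 1 =>
    rw [← norm_iteratedFDeriv_fderiv, norm_iteratedFDeriv_zero, L.fderiv]
    exact le_mul_of_one_le_right (norm_nonneg L) (by linarith [norm_nonneg p])
  | k + 2 =>
    have h : fderiv ℝ (fun p => L p) = fun _ => L := funext fun _ => L.fderiv
    rw [← norm_iteratedFDeriv_fderiv, h, iteratedFDeriv_const_of_ne (by omega)]
    simpa using by positivity

end DerivBound

section RapidDecay

variable {ι E F G H V : Type*} [NormedAddCommGroup E] [NormedSpace ℝ E]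
  [NormedAddCommGroup F] [NormedSpace ℝ F] [NormedAddCommGroup G] [NormedSpace ℝ G]
  [NormedAddCommGroup H] [NormedSpace ℝ H] [NormedAddCommGroup V] {T T₁ T₂ : Submodule ℝ (ι → ℝ)}
  {W W₁ W₂ : E → ℝ} {L : E → V} {f g : ι → E → F}

/-- All derivatives are bounded by `W p * (1 + ‖L p‖) ^ (-K)` for every `K`, up to factors
in `T`. -/
def RapidDecay (T : Submodule ℝ (ι → ℝ)) (W : E → ℝ) (L : E → V) (f : ι → E → F) : Prop :=
  ∀ K : ℕ, DerivBound T (fun p => W p * ((1 + ‖L p‖) ^ K)⁻¹) f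

namespace RapidDecay

theorem contDiff (hf : RapidDecay T W L f) (i : ι) : ContDiff ℝ ∞ (f i) := (hf 0).1 i

theorem derivBound (hf : RapidDecay T W L f) : DerivBound T W f := by simpa using hf 0

theorem mono_space (hf : RapidDecay T₁ W L f) (hT : T₁ ≤ T₂) : RapidDecay T₂ W L f :=
  fun K => (hf K).mono_space hT

theorem mono_weight (hf : RapidDecay T W₁ L f) {c : ℝ} (hc : 0 ≤ c) (hW : ∀ p, W₁ p ≤ c * W₂ p) :
    RapidDecay T W₂ L f := fun K => (hf K).mono_weight hc fun p => by
  rw [← mul_assoc]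
  exact mul_le_mul_of_nonneg_right (hW p) (by positivity)

theorem absorb {r : ℕ} (hf : RapidDecay T (fun p => W p * (1 + ‖L p‖) ^ r) L f) :
    RapidDecay T W L f := fun K => by
  convert hf (K + r) using 2 with p
  have : (1 + ‖L p‖) ^ r ≠ 0 := by positivity
  rw [pow_add]
  field_simp

theorem add (hf : RapidDecay T W L f) (hg : RapidDecay T W L g) :
    RapidDecay T W L fun i p => f i p + g i p :=
  fun K => (hf K).add (hg K)

theorem clm_comp (hf : RapidDecay T W L f) (A : F →L[ℝ] G) :
    RapidDecay T W L fun i p => A (f i p) :=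
  fun K => (hf K).clm_comp A

theorem comp_clm (hf : RapidDecay T W L f) (A : G →L[ℝ] E) :
    RapidDecay T (fun q => W (A q)) (fun q => L (A q)) fun i q => f i (A q) :=
  fun K => (hf K).comp_clm A

protected theorem fderiv (hf : RapidDecay T W L f) : RapidDecay T W L fun i => fderiv ℝ (f i) :=
  fun K => (hf K).fderiv

end RapidDecay

theorem DerivBound.bilinear_rapidDecay {g : ι → E → G} (hf : DerivBound T₁ W₁ f)
    (hg : RapidDecay T₂ W₂ L g) (B : F →L[ℝ] G →L[ℝ] H) :
    RapidDecay (T₁ * T₂) (fun p => W₁ p * W₂ p) L fun i p => B (f i p) (g i p) :=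
  fun K => by simpa only [mul_assoc] using hf.bilinear (hg K) B

end RapidDecay

section Fourier

variable {V F : Type*} [NormedAddCommGroup V]

theorem integrable_one_add_norm_pow_inv [NormedSpace ℝ V] [FiniteDimensional ℝ V]
    [MeasurableSpace V] [BorelSpace V] (μ : Measure V) [μ.IsAddHaarMeasure] :
    Integrable (fun v => ((1 + ‖v‖) ^ (Module.finrank ℝ V + 1))⁻¹) μ := by
  refine (integrable_one_add_norm (μ := μ) (r := (Module.finrank ℝ V + 1 : ℕ))
    (by push_cast; linarith)).congr (.of_forall fun v => ?_)
  beta_reduce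
  rw [Real.rpow_neg (by positivity), Real.rpow_natCast]

theorem integrable_of_norm_le_inv_pow [NormedSpace ℝ V] [FiniteDimensional ℝ V]
    [MeasurableSpace V] [BorelSpace V] {μ : Measure V} [μ.IsAddHaarMeasure]
    [NormedAddCommGroup F] {g : V → F} (hg : Continuous g) {B : ℝ}
    (h : ∀ v, ‖g v‖ ≤ B * ((1 + ‖v‖) ^ (Module.finrank ℝ V + 1))⁻¹) : Integrable g μ :=
  ((integrable_one_add_norm_pow_inv μ).const_mul B).mono' hg.aestronglyMeasurable (.of_forall h)

theorem norm_exp_I_mul_ofReal_smul [NormedAddCommGroup F] [NormedSpace ℂ F] (t : ℝ) (x : F) :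
    ‖Complex.exp (Complex.I * t) • x‖ = ‖x‖ := by
  rw [norm_smul, Complex.norm_exp_I_mul_ofReal, one_mul]

variable [InnerProductSpace ℝ V] [FiniteDimensional ℝ V] [MeasurableSpace V] [BorelSpace V]
  [NormedAddCommGroup F] [NormedSpace ℂ F]

theorem integral_exp_inner_smul_eq_fourier (g : V → F) (w : V) :
    ∫ v, Complex.exp (Complex.I * (⟪w, v⟫ : ℝ)) • g v = 𝓕 g (-(2 * Real.pi)⁻¹ • w) := by
  rw [Real.fourier_eq']
  congr with v
  rw [real_inner_smul_right, real_inner_comm]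
  congr 2
  push_cast
  field_simp

theorem norm_pow_mul_norm_integral_exp_le {g : V → F} {j : ℕ} (hg : ContDiff ℝ j g)
    (hint : ∀ k ≤ j, Integrable (iteratedFDeriv ℝ k g)) (w : V) :
    ‖w‖ ^ j * ‖∫ v, Complex.exp (Complex.I * (⟪w, v⟫ : ℝ)) • g v‖ ≤
      (4 * Real.pi) ^ j * ∑ k ∈ Finset.range (j + 1), ∫ v, ‖iteratedFDeriv ℝ k g v‖ := by
  have h := Real.pow_mul_norm_iteratedFDeriv_fourier_le (K := 0) (N := j) (k := 0) (n := j)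
    (mod_cast hg) (fun k l hk hl => by
      obtain rfl : k = 0 := by simpa using hk
      simpa using (hint l (mod_cast hl)).norm) le_rfl le_rfl (-(2 * Real.pi)⁻¹ • w)
  rw [norm_iteratedFDeriv_zero, ← integral_exp_inner_smul_eq_fourier, Finset.sum_product] at h
  simp only [zero_add, Finset.range_one, Finset.sum_singleton, pow_zero, one_mul,
    CharP.cast_eq_zero, mul_zero] at h
  set I := ∫ v, Complex.exp (Complex.I * (⟪w, v⟫ : ℝ)) • g v
  have hw : ‖w‖ = 2 * Real.pi * ‖-(2 * Real.pi)⁻¹ • w‖ := by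
    rw [norm_smul, norm_neg, norm_inv, Real.norm_of_nonneg (by positivity)]
    field_simp
  rw [hw, mul_pow, mul_assoc]
  calc _ ≤ (2 * Real.pi) ^ j *
          (2 ^ j * ∑ k ∈ Finset.range (j + 1), ∫ v, ‖iteratedFDeriv ℝ k g v‖) :=
        mul_le_mul_of_nonneg_left h (by positivity)
    _ = _ := by rw [← mul_assoc, ← mul_pow]; ring

theorem one_add_norm_pow_mul_norm_integral_exp_le {g : V → F} {j : ℕ} (hg : ContDiff ℝ j g)
    (hint : ∀ k ≤ j, Integrable (iteratedFDeriv ℝ k g)) (w : V) :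
    (1 + ‖w‖) ^ j * ‖∫ v, Complex.exp (Complex.I * (⟪w, v⟫ : ℝ)) • g v‖ ≤
      2 ^ (j - 1) * (1 + (4 * Real.pi) ^ j) *
        ∑ k ∈ Finset.range (j + 1), ∫ v, ‖iteratedFDeriv ℝ k g v‖ := by
  set I := ∫ v, Complex.exp (Complex.I * (⟪w, v⟫ : ℝ)) • g v
  set S := ∑ k ∈ Finset.range (j + 1), ∫ v, ‖iteratedFDeriv ℝ k g v‖
  have hI : ‖I‖ ≤ S := calc
    ‖I‖ ≤ ∫ v, ‖iteratedFDeriv ℝ 0 g v‖ := by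
      refine (norm_integral_le_integral_norm _).trans_eq
        (integral_congr_ae (.of_forall fun v => ?_))
      simp only [norm_exp_I_mul_ofReal_smul, norm_iteratedFDeriv_zero]
    _ ≤ S := Finset.single_le_sum (f := fun k => ∫ v, ‖iteratedFDeriv ℝ k g v‖)
      (fun k _ => integral_nonneg fun v => norm_nonneg _) (by simp)
  calc (1 + ‖w‖) ^ j * ‖I‖ ≤ 2 ^ (j - 1) * (1 ^ j + ‖w‖ ^ j) * ‖I‖ :=
        mul_le_mul_of_nonneg_right (add_pow_le zero_le_one (norm_nonneg w) j) (norm_nonneg I)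
    _ = 2 ^ (j - 1) * (‖I‖ + ‖w‖ ^ j * ‖I‖) := by ring
    _ ≤ 2 ^ (j - 1) * (S + (4 * Real.pi) ^ j * S) :=
      mul_le_mul_of_nonneg_left (add_le_add hI (norm_pow_mul_norm_integral_exp_le hg hint w))
        (by positivity)
    _ = _ := by ring

end Fourier

section PartialFourier

universe u

variable {ι V : Type*} {Z F : Type u} [NormedAddCommGroup Z] [NormedSpace ℝ Z]
  [NormedAddCommGroup V] [InnerProductSpace ℝ V] [NormedAddCommGroup F] [NormedSpace ℂ F]
  {T : Submodule ℝ (ι → ℝ)} {w : Z → ℝ} {b : ι → Z × V → F}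

omit [InnerProductSpace ℝ V] in
theorem norm_iteratedFDeriv_prodMk_le [NormedSpace ℝ V] {b : Z × V → F} (hb : ContDiff ℝ ∞ b)
    (k : ℕ) (z : Z) (v : V) :
    ‖iteratedFDeriv ℝ k (fun v => b (z, v)) v‖ ≤ ‖iteratedFDeriv ℝ k b (z, v)‖ := by
  have h := norm_iteratedFDeriv_comp_clm_le (f := fun p => b ((z, 0) + p))
    (hb.comp (contDiff_const.add contDiff_id)) (ContinuousLinearMap.inr ℝ Z V) k v
  simp only [iteratedFDeriv_comp_add_left, ContinuousLinearMap.inr_apply, Prod.mk_add_mk,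
    add_zero, zero_add] at h
  exact h.trans (mul_le_of_le_one_left (norm_nonneg _)
    (pow_le_one₀ (norm_nonneg _) (ContinuousLinearMap.norm_inr_le_one ℝ Z V)))

/-- The linear forms `z ↦ ⟨L z, v⟩`, linearly in `v`. -/
noncomputable def phaseForm (L : Z →L[ℝ] V) : V →L[ℝ] Z →L[ℝ] ℝ :=
  ((ContinuousLinearMap.compL ℝ Z V ℝ).flip L).comp (innerSL ℝ)

theorem phaseForm_apply (L : Z →L[ℝ] V) (v : V) (z : Z) : phaseForm L v z = ⟪L z, v⟫ := by
  rw [real_inner_comm]; rfl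

/-- The amplitude which arises when `e^{i⟨L z, v⟩} b(z, v)` is differentiated in `z`. -/
noncomputable def derivAmplitude (L : Z →L[ℝ] V) (b : Z × V → F) (p : Z × V) : Z →L[ℝ] F :=
  (fderiv ℝ b p).comp (ContinuousLinearMap.inl ℝ Z V) +
    Complex.I • (phaseForm L p.2).smulRight (b p)

theorem hasFDerivAt_exp_smul (L : Z →L[ℝ] V) {b : Z × V → F} (hb : ContDiff ℝ ∞ b) (z : Z)
    (v : V) :
    HasFDerivAt (fun z => Complex.exp (Complex.I * (⟪L z, v⟫ : ℝ)) • b (z, v))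
      (Complex.exp (Complex.I * (⟪L z, v⟫ : ℝ)) • derivAmplitude L b (z, v)) z := by
  have hb' : HasFDerivAt (fun z => b (z, v))
      ((fderiv ℝ b (z, v)).comp (ContinuousLinearMap.inl ℝ Z V)) z :=
    ((hb.differentiable (by simp)).differentiableAt.hasFDerivAt (x := (z, v))).comp z
      (hasFDerivAt_prodMk_left z v)
  have hphase : HasFDerivAt (fun z => ⟪L z, v⟫) (phaseForm L v) z := by
    simp_rw [← phaseForm_apply]
    exact (phaseForm L v).hasFDerivAt
  have hexp : HasFDerivAt (fun z => Complex.exp (Complex.I * (⟪L z, v⟫ : ℝ)))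
      (Complex.exp (Complex.I * (⟪L z, v⟫ : ℝ)) •
        (Complex.I • Complex.ofRealCLM.comp (phaseForm L v))) z :=
    ((Complex.ofRealCLM.hasFDerivAt.comp z hphase).const_mul Complex.I).cexp
  refine (hexp.smul hb').congr_fderiv ?_
  ext y
  simp only [derivAmplitude, add_apply, smul_apply, ContinuousLinearMap.smulRight_apply,
    ContinuousLinearMap.comp_apply, smul_add, Complex.ofRealCLM_apply, smul_eq_mul, mul_smul]
  rfl

protected theorem RapidDecay.derivAmplitude (L : Z →L[ℝ] V)
    (hb : RapidDecay T (fun p => w p.1) Prod.snd b) :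
    RapidDecay T (fun p => w p.1) Prod.snd fun i => derivAmplitude L (b i) := by
  have hderiv := hb.fderiv.clm_comp
    ((ContinuousLinearMap.compL ℝ Z (Z × V) F).flip (ContinuousLinearMap.inl ℝ Z V))
  have hphase := (derivBound_clm (ι := ι) (phaseForm L)).comp_clm (ContinuousLinearMap.snd ℝ Z V)
  have hsmul := ((hphase.bilinear_rapidDecay hb (ContinuousLinearMap.smulRightL ℝ Z F)).mono_space
    (one_mul T).le).clm_comp (Complex.I • ContinuousLinearMap.id ℝ (Z →L[ℝ] F))
  exact hderiv.add (RapidDecay.absorb (r := 1) (by simpa [mul_comm] using hsmul))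

theorem RapidDecay.norm_iteratedFDeriv_slice_le (hb : RapidDecay T (fun p => w p.1) Prod.snd b)
    (k : ℕ) : ∃ C ∈ T, 0 ≤ C ∧ ∀ i z v, ‖iteratedFDeriv ℝ k (fun v => b i (z, v)) v‖ ≤
      C i * w z * ((1 + ‖v‖) ^ (Module.finrank ℝ V + 1))⁻¹ := by
  obtain ⟨C, hC, hC0, h⟩ := (hb (Module.finrank ℝ V + 1)).2 k
  refine ⟨C, hC, hC0, fun i z v => (norm_iteratedFDeriv_prodMk_le (hb.contDiff i) k z v).trans ?_⟩
  rw [mul_assoc]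
  exact h i (z, v)

variable [FiniteDimensional ℝ V] [MeasurableSpace V] [BorelSpace V]

/-- `∫ e^{i⟨L z, v⟩} b(z, v) dv`. -/
noncomputable def partialFourier (L : Z →L[ℝ] V) (b : Z × V → F) (z : Z) : F :=
  ∫ v, Complex.exp (Complex.I * (⟪L z, v⟫ : ℝ)) • b (z, v)

theorem RapidDecay.integrable_exp_smul (hb : RapidDecay T (fun p => w p.1) Prod.snd b)
    (L : Z →L[ℝ] V) (i : ι) (z : Z) :
    Integrable fun v => Complex.exp (Complex.I * (⟪L z, v⟫ : ℝ)) • b i (z, v) := by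
  obtain ⟨C, -, -, hC⟩ := (hb (Module.finrank ℝ V + 1)).norm
  have := (hb.contDiff i).continuous
  refine integrable_of_norm_le_inv_pow (B := C i * w z) (by fun_prop) fun v => ?_
  rw [norm_exp_I_mul_ofReal_smul, mul_assoc]
  exact hC i (z, v)

theorem hasFDerivAt_partialFourier (hw : Continuous w) (L : Z →L[ℝ] V)
    (hb : RapidDecay T (fun p => w p.1) Prod.snd b) (i : ι) (z : Z) :
    HasFDerivAt (partialFourier L (b i)) (partialFourier L (derivAmplitude L (b i)) z) z := by
  have hb' := hb.derivAmplitude L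
  obtain ⟨C, -, hC0, hC⟩ := (hb' (Module.finrank ℝ V + 1)).norm
  have hs : {y | w y < w z + 1} ∈ 𝓝 z :=
    hw.continuousAt.eventually (gt_mem_nhds (lt_add_one (w z)))
  refine hasFDerivAt_integral_of_dominated_of_fderiv_le
    (bound := fun v => C i * (w z + 1) * ((1 + ‖v‖) ^ (Module.finrank ℝ V + 1))⁻¹) hs
    (.of_forall fun y => (hb.integrable_exp_smul L i y).aestronglyMeasurable)
    (hb.integrable_exp_smul L i z) (hb'.integrable_exp_smul L i z).aestronglyMeasurable
    (.of_forall fun v y hy => ?_) ((integrable_one_add_norm_pow_inv volume).const_mul _)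
    (.of_forall fun v y _ => hasFDerivAt_exp_smul L (hb.contDiff i) y v)
  rw [mul_assoc]
  refine (norm_exp_I_mul_ofReal_smul _ (derivAmplitude L (b i) (y, v))).trans_le ?_
  exact (hC i (y, v)).trans (mul_le_mul_of_nonneg_left
    (mul_le_mul_of_nonneg_right (le_of_lt hy) (by positivity)) (hC0 i))

theorem RapidDecay.integrable_iteratedFDeriv_slice
    (hb : RapidDecay T (fun p => w p.1) Prod.snd b) (k : ℕ) (i : ι) (z : Z) :
    Integrable (iteratedFDeriv ℝ k fun v => b i (z, v)) :=
  let ⟨_, _, _, hC⟩ := hb.norm_iteratedFDeriv_slice_le k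
  integrable_of_norm_le_inv_pow (((hb.contDiff i).comp
    (contDiff_prodMk_right z)).continuous_iteratedFDeriv (by exact_mod_cast le_top)) (hC i z)

theorem RapidDecay.weightedBound_integral_slice
    (hb : RapidDecay T (fun p => w p.1) Prod.snd b) (k : ℕ) :
    WeightedBound T w fun i z => ∫ v, ‖iteratedFDeriv ℝ k (fun v => b i (z, v)) v‖ := by
  obtain ⟨C, hC, hC0, h⟩ := hb.norm_iteratedFDeriv_slice_le k
  set M := ∫ v : V, ((1 + ‖v‖) ^ (Module.finrank ℝ V + 1))⁻¹
  have hM : 0 ≤ M := integral_nonneg fun v => by positivity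
  refine WeightedBound.mono_weight (W₁ := fun z => w z * M) ⟨C, hC, hC0, fun i z => ?_⟩ hM
    fun z => (mul_comm _ _).le
  calc _ ≤ ∫ v, C i * w z * ((1 + ‖v‖) ^ (Module.finrank ℝ V + 1))⁻¹ :=
        integral_mono (hb.integrable_iteratedFDeriv_slice k i z).norm
          ((integrable_one_add_norm_pow_inv volume).const_mul _) (h i z)
    _ = C i * (w z * M) := by rw [integral_const_mul, mul_assoc]

theorem RapidDecay.weightedBound_partialFourier (L : Z →L[ℝ] V)
    (hb : RapidDecay T (fun p => w p.1) Prod.snd b) (j : ℕ) :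
    WeightedBound T (fun z => w z * ((1 + ‖L z‖) ^ j)⁻¹) fun i z => ‖partialFourier L (b i) z‖ := by
  obtain ⟨C, hC, hC0, h⟩ := WeightedBound.mono
    (.const_mul (.sum fun k _ => hb.weightedBound_integral_slice k) (by positivity)) fun i z =>
      one_add_norm_pow_mul_norm_integral_exp_le (j := j)
        (((hb.contDiff i).comp (contDiff_prodMk_right z)).of_le (by exact_mod_cast le_top))
        (fun k _ => hb.integrable_iteratedFDeriv_slice k i z) (L z)
  refine ⟨C, hC, hC0, fun i z => ?_⟩
  rw [← mul_assoc, ← div_eq_mul_inv, le_div_iff₀' (by positivity)]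
  exact h i z

theorem RapidDecay.contDiff_partialFourier (hw : Continuous w) (L : Z →L[ℝ] V)
    (hb : RapidDecay T (fun p => w p.1) Prod.snd b) (k : ℕ) (i : ι) :
    ContDiff ℝ k (partialFourier L (b i)) := by
  have hd := hasFDerivAt_partialFourier hw L hb i
  induction k generalizing F with
  | zero => exact contDiff_zero.2 (continuous_iff_continuousAt.2 fun z => (hd z).continuousAt)
  | succ k ih =>
    rw [Nat.cast_add, Nat.cast_one, contDiff_succ_iff_fderiv, funext fun z => (hd z).fderiv]
    exact ⟨fun z => (hd z).differentiableAt, by simp, ih (hb.derivAmplitude L)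
      (hasFDerivAt_partialFourier hw L (hb.derivAmplitude L) i)⟩

theorem RapidDecay.weightedBound_iteratedFDeriv_partialFourier (hw : Continuous w)
    (L : Z →L[ℝ] V) (hb : RapidDecay T (fun p => w p.1) Prod.snd b) (k j : ℕ) :
    WeightedBound T (fun z => w z * ((1 + ‖L z‖) ^ j)⁻¹)
      fun i z => ‖iteratedFDeriv ℝ k (partialFourier L (b i)) z‖ := by
  induction k generalizing F with
  | zero => simpa only [norm_iteratedFDeriv_zero] using hb.weightedBound_partialFourier L j
  | succ k ih =>
    have hd : ∀ i, fderiv ℝ (partialFourier L (b i)) = _ := fun i =>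
      funext fun z => (hasFDerivAt_partialFourier hw L hb i z).fderiv
    simp_rw [← norm_iteratedFDeriv_fderiv, hd]
    exact ih (hb.derivAmplitude L)

protected theorem RapidDecay.partialFourier (hw : Continuous w) (L : Z →L[ℝ] V)
    (hb : RapidDecay T (fun p => w p.1) Prod.snd b) :
    RapidDecay T w L fun i => partialFourier L (b i) := fun j =>
  ⟨fun i => contDiff_infty.2 fun k => hb.contDiff_partialFourier hw L k i,
    fun k => hb.weightedBound_iteratedFDeriv_partialFourier hw L k j⟩

end PartialFourier

section Symmetry

variable {V F : Type*} [NormedAddCommGroup V] [NormedSpace ℝ V] [NormedAddCommGroup F]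
  [NormedSpace ℝ F] {f : V → F}

theorem contDiff_iteratedFDeriv_apply (hf : ContDiff ℝ ∞ f) {k : ℕ} (v : Fin k → V) :
    ContDiff ℝ ∞ fun x => iteratedFDeriv ℝ k f x v :=
  (ContinuousMultilinearMap.apply ℝ (fun _ : Fin k => V) F v).contDiff.comp
    (hf.iteratedFDeriv_right (m := ∞) (i := k) (by exact_mod_cast le_top))

theorem iteratedFDeriv_succ_apply_eq_fderiv (hf : ContDiff ℝ ∞ f) {k : ℕ} (x : V)
    (v : Fin (k + 1) → V) :
    iteratedFDeriv ℝ (k + 1) f x v =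
      fderiv ℝ (fun y => iteratedFDeriv ℝ k f y (Fin.tail v)) x (v 0) :=
  (hf.differentiable_iteratedFDeriv
    (by exact_mod_cast ENat.natCast_lt_top k)).differentiableAt.iteratedFDeriv_succ_apply_left'

theorem iteratedFDeriv_add_two_apply_eq_fderiv (hf : ContDiff ℝ ∞ f) {k : ℕ} (x : V)
    (v : Fin (k + 2) → V) :
    iteratedFDeriv ℝ (k + 2) f x v =
      fderiv ℝ (fderiv ℝ fun y => iteratedFDeriv ℝ k f y (Fin.tail (Fin.tail v))) x
        (v 0) (v 1) := by
  have hd : DifferentiableAt ℝ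
      (fderiv ℝ fun y => iteratedFDeriv ℝ k f y (Fin.tail (Fin.tail v))) x :=
    ((contDiff_iteratedFDeriv_apply hf _).fderiv_right (m := ∞)
      (by exact_mod_cast le_top)).differentiable (by simp) |>.differentiableAt
  simp_rw [iteratedFDeriv_succ_apply_eq_fderiv hf]
  rw [fderiv_clm_apply hd (differentiableAt_const _)]
  simp [Fin.tail]

theorem iteratedFDeriv_apply_comp_swap_zero_one (hf : ContDiff ℝ ∞ f) {k : ℕ} (x : V)
    (v : Fin (k + 2) → V) :
    iteratedFDeriv ℝ (k + 2) f x (v ∘ Equiv.swap 0 1) = iteratedFDeriv ℝ (k + 2) f x v := by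
  have hsymm := ((contDiff_iteratedFDeriv_apply hf (Fin.tail (Fin.tail v))).contDiffAt
    (x := x)).isSymmSndFDerivAt (by
      rw [minSmoothness_of_isRCLikeNormedField]
      exact WithTop.coe_le_coe.2 (le_top : (2 : ℕ∞) ≤ ⊤))
  have htail : Fin.tail (Fin.tail (v ∘ Equiv.swap 0 1)) = Fin.tail (Fin.tail v) := by
    ext1 j
    simp only [Fin.tail, Function.comp_apply]
    rw [Equiv.swap_apply_of_ne_of_ne (by simp [Fin.ext_iff]) (by simp [Fin.ext_iff])]
  rw [iteratedFDeriv_add_two_apply_eq_fderiv hf, iteratedFDeriv_add_two_apply_eq_fderiv hf, htail,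
    hsymm]
  simp

theorem iteratedFDeriv_apply_comp_swap (hf : ContDiff ℝ ∞ f) {k : ℕ} (i : Fin k) (x : V)
    (v : Fin (k + 1) → V) :
    iteratedFDeriv ℝ (k + 1) f x (v ∘ Equiv.swap i.castSucc i.succ) =
      iteratedFDeriv ℝ (k + 1) f x v := by
  induction k generalizing x with
  | zero => exact i.elim0
  | succ k ih =>
    cases i using Fin.cases with
    | zero => exact iteratedFDeriv_apply_comp_swap_zero_one hf x v
    | succ j =>
      have hhead : (v ∘ Equiv.swap j.succ.castSucc j.succ.succ) 0 = v 0 := by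
        rw [Function.comp_apply,
          Equiv.swap_apply_of_ne_of_ne (by simp [Fin.ext_iff]) (by simp [Fin.ext_iff])]
      have htail : Fin.tail (v ∘ Equiv.swap j.succ.castSucc j.succ.succ) =
          Fin.tail v ∘ Equiv.swap j.castSucc j.succ := by
        ext1 l
        simp only [Fin.tail, Function.comp_apply]
        congr 1
        exact (Fin.succ_injective _).swap_apply j.castSucc j.succ l
      rw [iteratedFDeriv_succ_apply_eq_fderiv hf, iteratedFDeriv_succ_apply_eq_fderiv hf, hhead,
        htail, funext fun y => ih j y (Fin.tail v)]

theorem iteratedFDeriv_apply_comp_perm (hf : ContDiff ℝ ∞ f) {k : ℕ} (x : V)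
    (σ : Equiv.Perm (Fin k)) (v : Fin k → V) :
    iteratedFDeriv ℝ k f x (v ∘ σ) = iteratedFDeriv ℝ k f x v := by
  cases k with
  | zero => congr 1; exact Subsingleton.elim _ _
  | succ k =>
    have hσ : σ ∈ Submonoid.closure (Set.range fun i : Fin k => Equiv.swap i.castSucc i.succ) := by
      rw [Equiv.Perm.mclosure_swap_castSucc_succ]; trivial
    induction hσ using Submonoid.closure_induction generalizing v with
    | mem σ h =>
      obtain ⟨i, rfl⟩ := h
      exact iteratedFDeriv_apply_comp_swap hf i x v
    | one => rfl
    | mul σ τ _ _ hσ hτ => rw [Equiv.Perm.coe_mul, ← Function.comp_assoc, hτ, hσ]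

theorem iteratedFDeriv_apply_comp_equiv (hf : ContDiff ℝ ∞ f) (x : V) {k l : ℕ}
    (σ : Fin l ≃ Fin k) (v : Fin k → V) :
    iteratedFDeriv ℝ l f x (v ∘ σ) = iteratedFDeriv ℝ k f x v := by
  obtain rfl : l = k := by simpa using Fintype.card_congr σ
  exact iteratedFDeriv_apply_comp_perm hf x σ v

end Symmetry

section Coordinates

theorem norm_le_sum_norm_apply_basis {𝕜 κ V F : Type*} [NontriviallyNormedField 𝕜]
    [CompleteSpace 𝕜] [Fintype κ] [NormedAddCommGroup V] [NormedSpace 𝕜 V] [FiniteDimensional 𝕜 V]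
    [NormedAddCommGroup F] [NormedSpace 𝕜 F] (e : Module.Basis κ 𝕜 V) {k : ℕ}
    (g : ContinuousMultilinearMap 𝕜 (fun _ : Fin k => V) F) :
    ‖g‖ ≤ ∑ s : Fin k → κ, (∏ i, ‖(e.coord (s i)).toContinuousLinearMap‖) *
      ‖g fun i => e (s i)‖ := by
  classical
  refine g.opNorm_le_bound (by positivity) fun m => ?_
  have hexpand : g m = ∑ s : Fin k → κ, (∏ i, e.coord (s i) (m i)) • g fun i => e (s i) := by
    conv_lhs => rw [← funext fun i => e.sum_repr (m i)]
    rw [g.map_sum]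
    exact Finset.sum_congr rfl fun s _ => g.map_smul_univ _ _
  rw [hexpand, Finset.sum_mul]
  refine (norm_sum_le _ _).trans (Finset.sum_le_sum fun s _ => ?_)
  rw [norm_smul, norm_prod, mul_right_comm, ← Finset.prod_mul_distrib]
  refine mul_le_mul_of_nonneg_right (Finset.prod_le_prod (fun _ _ => norm_nonneg _) fun i _ => ?_)
    (norm_nonneg _)
  exact (e.coord (s i)).toContinuousLinearMap.le_opNorm (m i)

variable {ι κ V F : Type*} [Finite κ] [NormedAddCommGroup V] [NormedSpace ℝ V]
  [NormedAddCommGroup F] [NormedSpace ℝ F] {T : Submodule ℝ (ι → ℝ)} {W : V → ℝ} {f : ι → V → F}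

theorem weightedBound_iteratedFDeriv_of_basis (e : Module.Basis κ ℝ V) {k : ℕ}
    (h : ∀ s : Fin k → κ,
      WeightedBound T W fun i p => ‖iteratedFDeriv ℝ k (f i) p fun j => e (s j)‖) :
    WeightedBound T W fun i p => ‖iteratedFDeriv ℝ k (f i) p‖ := by
  classical
  have := Fintype.ofFinite κ
  have := e.finiteDimensional_of_finite
  exact (WeightedBound.sum fun s _ => (h s).const_mul (by positivity)).mono fun i p =>
    norm_le_sum_norm_apply_basis e (iteratedFDeriv ℝ k (f i) p)

end Coordinates

section MultiIndices

variable {n k : ℕ}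

theorem exists_sigma_fin_equiv {A κ : Type*} [Finite A] (s : A → κ) :
    ∃ (N : κ → ℕ) (σ : (Σ c, Fin (N c)) ≃ A), ∀ p, s (σ p) = p.1 := by
  refine ⟨fun c => Nat.card {a // s a = c}, (Equiv.sigmaCongrRight fun c =>
    (Finite.equivFin _).symm).trans (Equiv.sigmaFiberEquiv s), fun p => ?_⟩
  exact ((Finite.equivFin {a // s a = p.1}).symm p.2).2

/-- The coordinate vectors of `ℝ³ⁿ` in the order of the derivatives in `partialD₃`: first those of
the third factor, then those of the first, then those of the second. -/
noncomputable def basis₃ (n : ℕ) :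
    Module.Basis ((Fin n ⊕ Fin n) ⊕ Fin n) ℝ (Rn n × Rn n × Rn n) :=
  let e := (EuclideanSpace.basisFun (Fin n) ℝ).toBasis
  (e.prod (e.prod e)).reindex <| (Equiv.sumCongr (.refl _) (.sumComm _ _)).trans <|
    (Equiv.sumAssoc _ _ _).symm.trans <| Equiv.sumCongr (.sumComm _ _) (.refl _)

theorem exists_partialD_eq (s : Fin k → Fin n) :
    ∃ α : Fin n → ℕ, ∀ f : Rn n → ℂ, ContDiff ℝ ∞ f → ∀ x,
      iteratedFDeriv ℝ k f x (fun j => (EuclideanSpace.basisFun (Fin n) ℝ).toBasis (s j)) =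
        partialD α f x := by
  obtain ⟨α, σ, hσ⟩ := exists_sigma_fin_equiv s
  refine ⟨α, fun f hf x => ?_⟩
  rw [← iteratedFDeriv_apply_comp_equiv hf x (finSigmaFinEquiv.symm.trans σ), partialD]
  congr 1
  ext1 j
  simp [hσ, directions]

theorem exists_partialD₃_eq (s : Fin k → (Fin n ⊕ Fin n) ⊕ Fin n) :
    ∃ α β γ : Fin n → ℕ, ∀ f : Rn n × Rn n × Rn n → ℂ, ContDiff ℝ ∞ f → ∀ p,
      iteratedFDeriv ℝ k f p (fun j => basis₃ n (s j)) = partialD₃ α β γ f p := by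
  obtain ⟨N, σ, hσ⟩ := exists_sigma_fin_equiv s
  let α i := N (.inl (.inl i))
  let β i := N (.inl (.inr i))
  let γ i := N (.inr i)
  let τ : Fin (order α + order β + order γ) ≃ Σ c, Fin (N c) :=
    finSumFinEquiv.symm.trans <| (Equiv.sumCongr (finSumFinEquiv.symm.trans <|
      (Equiv.sumCongr finSigmaFinEquiv.symm finSigmaFinEquiv.symm).trans
        (Equiv.sumSigmaDistrib fun c => Fin (N (.inl c))).symm) finSigmaFinEquiv.symm).trans
      (Equiv.sumSigmaDistrib fun c => Fin (N c)).symm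
  refine ⟨α, β, γ, fun f hf p => ?_⟩
  rw [← iteratedFDeriv_apply_comp_equiv hf p (τ.trans σ), partialD₃]
  congr 1
  ext1 j
  cases j using Fin.addCases with
  | left j =>
    cases j using Fin.addCases <;>
      simp [τ, α, β, γ, hσ, basis₃, directions, Prod.mk_zero_zero]
  | right j => simp [τ, α, β, γ, hσ, basis₃, directions]

theorem norm_partialD_le (α : Fin n → ℕ) (f : Rn n → ℂ) (x : Rn n) :
    ‖partialD α f x‖ ≤ ‖iteratedFDeriv ℝ (order α) f x‖ :=
  ((iteratedFDeriv ℝ (order α) f x).le_opNorm _).trans_eq (by simp [directions])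

variable {ι : Type*} {T : Submodule ℝ (ι → ℝ)}

theorem derivBound_of_partialD₃ {W : Rn n × Rn n × Rn n → ℝ} {f : ι → Rn n × Rn n × Rn n → ℂ}
    (hf : ∀ i, ContDiff ℝ ∞ (f i))
    (h : ∀ α β γ : Fin n → ℕ, WeightedBound T W fun i p => ‖partialD₃ α β γ (f i) p‖) :
    DerivBound T W f :=
  ⟨hf, fun _ => weightedBound_iteratedFDeriv_of_basis (basis₃ n) fun s => by
    obtain ⟨α, β, γ, hs⟩ := exists_partialD₃_eq s
    simpa only [hs _ (hf _)] using h α β γ⟩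

end MultiIndices

section ParameterDependence

variable {E : Type*} {W : E → ℝ} {X : Param → E → ℝ}

theorem isBigO_inv_pow_of_le {N M : ℕ} (h : N ≤ M) :
    (fun ε : Param => ((ε : ℝ) ^ N)⁻¹) =O[⊤] fun ε : Param => ((ε : ℝ) ^ M)⁻¹ :=
  isBigO_top.2 ⟨1, fun ε => by
    have hε : (0 : ℝ) < ε := ε.2.1
    rw [norm_inv, norm_inv, one_mul, Real.norm_of_nonneg (by positivity),
      Real.norm_of_nonneg (by positivity)]
    exact inv_anti₀ (by positivity) (pow_le_pow_of_le_one hε.le ε.2.2 h)⟩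

/-- The functions of `ε` which grow at most polynomially in `ε⁻¹`. -/
def moderate : Submodule ℝ (Param → ℝ) where
  carrier := {C | ∃ N : ℕ, C =O[⊤] fun ε => ((ε : ℝ) ^ N)⁻¹}
  zero_mem' := ⟨0, isBigO_zero _ _⟩
  add_mem' := fun ⟨N, hC⟩ ⟨M, hD⟩ =>
    ⟨N + M, (hC.trans (isBigO_inv_pow_of_le (Nat.le_add_right N M))).add
      (hD.trans (isBigO_inv_pow_of_le (Nat.le_add_left M N)))⟩
  smul_mem' := fun c _ ⟨N, hC⟩ => ⟨N, hC.const_smul_left c⟩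

/-- The functions of `ε` which are `O(ε ^ q)` for every `q`. -/
def negligible : Submodule ℝ (Param → ℝ) where
  carrier := {C | ∀ q : ℕ, C =O[⊤] fun ε => (ε : ℝ) ^ q}
  zero_mem' := fun _ => isBigO_zero _ _
  add_mem' := fun hC hD q => (hC q).add (hD q)
  smul_mem' := fun c _ hC q => (hC q).const_smul_left c

theorem moderate_mul_moderate_le : moderate * moderate ≤ moderate :=
  Submodule.mul_le.2 fun _ ⟨N, hC⟩ _ ⟨M, hD⟩ => ⟨N + M, (hC.mul hD).congr_right fun ε => by
    rw [pow_add, mul_inv]⟩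

theorem moderate_mul_negligible_le : moderate * negligible ≤ negligible := by
  refine Submodule.mul_le.2 fun C ⟨N, hC⟩ D hD q => (hC.mul (hD (N + q))).congr_right fun ε => ?_
  have hε : (ε : ℝ) ≠ 0 := ε.2.1.ne'
  rw [pow_add, inv_mul_cancel_left₀ (pow_ne_zero N hε)]

theorem weightedBound_moderate_iff (hW : ∀ p, 0 ≤ W p) :
    WeightedBound moderate W X ↔
      ∃ (N : ℕ) (c : ℝ), ∀ (ε : Param) p, (ε : ℝ) ^ N * X ε p ≤ c * W p := by
  constructor
  · rintro ⟨C, ⟨N, hC⟩, -, h⟩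
    obtain ⟨c, hc⟩ := isBigO_top.1 hC
    refine ⟨N, c, fun ε p => ?_⟩
    have hε : (0 : ℝ) < ε := ε.2.1
    calc (ε : ℝ) ^ N * X ε p ≤ (ε : ℝ) ^ N * (c * ‖((ε : ℝ) ^ N)⁻¹‖ * W p) := by
          gcongr
          exact (h ε p).trans
            (mul_le_mul_of_nonneg_right ((Real.le_norm_self _).trans (hc ε)) (hW p))
      _ = c * W p := by
          rw [Real.norm_of_nonneg (by positivity)]
          field_simp
  · rintro ⟨N, c, h⟩
    refine ⟨fun ε => |c| * ((ε : ℝ) ^ N)⁻¹, ⟨N, isBigO_const_mul_self _ _ _⟩, fun ε => ?_,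
      fun ε p => ?_⟩ <;> have hε : (0 : ℝ) < ε := ε.2.1
    · positivity
    · rw [mul_right_comm, ← div_eq_mul_inv, le_div_iff₀' (by positivity)]
      exact (h ε p).trans (mul_le_mul_of_nonneg_right (le_abs_self c) (hW p))

theorem weightedBound_negligible_iff (hW : ∀ p, 0 < W p) :
    WeightedBound negligible W X ↔
      ∀ q : ℕ, ∃ c : ℝ, ∀ (ε : Param) p, ((ε : ℝ) ^ q)⁻¹ * X ε p ≤ c * W p := by
  constructor
  · rintro ⟨C, hC, -, h⟩ q
    obtain ⟨c, hc⟩ := isBigO_top.1 (hC q)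
    refine ⟨c, fun ε p => ?_⟩
    have hε : (0 : ℝ) < ε := ε.2.1
    have hCε := (Real.le_norm_self _).trans (hc ε)
    rw [Real.norm_of_nonneg (by positivity)] at hCε
    rw [inv_mul_le_iff₀ (by positivity), ← mul_assoc, mul_comm _ c]
    exact (h ε p).trans (mul_le_mul_of_nonneg_right hCε (hW p).le)
  · intro h
    choose c hc using h
    have hpos (ε : Param) (q : ℕ) : 0 ≤ |c q| * (ε : ℝ) ^ q :=
      mul_nonneg (abs_nonneg _) (pow_nonneg ε.2.1.le _)
    have hinf (ε : Param) : 0 ≤ ⨅ q, |c q| * (ε : ℝ) ^ q := le_ciInf (hpos ε)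
    refine ⟨fun ε => ⨅ q, |c q| * (ε : ℝ) ^ q, fun q => isBigO_top.2 ⟨|c q|, fun ε => ?_⟩, hinf,
      fun ε p => ?_⟩
    · rw [Real.norm_of_nonneg (hinf ε), Real.norm_of_nonneg (pow_nonneg ε.2.1.le _)]
      exact ciInf_le ⟨0, Set.forall_mem_range.2 (hpos ε)⟩ q
    · rw [← div_le_iff₀ (hW p)]
      refine le_ciInf fun q => (div_le_iff₀ (hW p)).2 ?_
      have h := hc q ε p
      rw [inv_mul_le_iff₀ (pow_pos ε.2.1 q), ← mul_assoc, mul_comm _ (c q)] at h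
      exact h.trans (mul_le_mul_of_nonneg_right
        (mul_le_mul_of_nonneg_right (le_abs_self _) (pow_nonneg ε.2.1.le _)) (hW p).le)

end ParameterDependence

section Tempered

variable {V : Type} [NormedAddCommGroup V]

/-- A positive function which grows at most polynomially, and so does its inverse. -/
def IsTempered (w : V → ℝ) : Prop :=
  (∀ z, 0 < w z) ∧ ∃ (c : ℝ) (N : ℕ), ∀ z, w z ≤ c * (1 + ‖z‖) ^ N ∧ (w z)⁻¹ ≤ c * (1 + ‖z‖) ^ N

theorem IsTempered.exists_rpow_le {w : V → ℝ} (hw : IsTempered w) (m : ℝ) :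
    ∃ (c : ℝ) (r : ℕ), 0 ≤ c ∧ ∀ z, w z ^ m ≤ c * (1 + ‖z‖) ^ r := by
  obtain ⟨hpos, c, N, h⟩ := hw
  refine ⟨max c 1 ^ ⌈|m|⌉₊, N * ⌈|m|⌉₊, by positivity, fun z => ?_⟩
  set B := max c 1 * (1 + ‖z‖) ^ N
  have hB : 1 ≤ B := one_le_mul_of_one_le_of_one_le (le_max_right c 1)
    (one_le_pow₀ (le_add_of_nonneg_right (norm_nonneg z)))
  have hcB : c * (1 + ‖z‖) ^ N ≤ B :=
    mul_le_mul_of_nonneg_right (le_max_left c 1) (by positivity)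
  calc w z ^ m ≤ B ^ |m| := by
        rcases le_total 0 m with hm | hm
        · rw [abs_of_nonneg hm]
          exact Real.rpow_le_rpow (hpos z).le ((h z).1.trans hcB) hm
        · calc w z ^ m = (w z)⁻¹ ^ (-m) := by rw [← Real.rpow_neg_eq_inv_rpow, neg_neg]
            _ ≤ B ^ (-m) := Real.rpow_le_rpow (inv_pos.2 (hpos z)).le ((h z).2.trans hcB)
              (neg_nonneg.2 hm)
            _ = B ^ |m| := by rw [abs_of_nonpos hm]
    _ ≤ B ^ (⌈|m|⌉₊ : ℝ) := Real.rpow_le_rpow_of_exponent_le hB (Nat.le_ceil _)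
    _ = _ := by rw [Real.rpow_natCast, mul_pow, pow_mul]

theorem one_le_japanese (x : V) : 1 ≤ japanese x :=
  Real.one_le_sqrt.2 (le_add_of_nonneg_right (sq_nonneg ‖x‖))

theorem japanese_le_one_add_norm (x : V) : japanese x ≤ 1 + ‖x‖ :=
  Real.sqrt_le_iff.2 ⟨by positivity, by nlinarith [norm_nonneg x]⟩

theorem isTempered_japanese : IsTempered (japanese : V → ℝ) := by
  refine ⟨fun x => zero_lt_one.trans_le (one_le_japanese x), 1, 1, fun x => ?_⟩
  rw [one_mul, pow_one]
  exact ⟨japanese_le_one_add_norm x, (inv_le_one_of_one_le₀ (one_le_japanese x)).trans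
    (le_add_of_nonneg_right (norm_nonneg x))⟩

variable {n : ℕ} {Λ : R2n n → ℝ}

theorem IsWeight.isTempered (hΛ : IsWeight Λ) : IsTempered Λ := by
  obtain ⟨μ, hμ, ⟨c₁, hc₁, h₁⟩, ⟨c₂, hc₂, h₂⟩, -, -⟩ := hΛ.bounds
  have hlow z : 1 ≤ c₁ * Λ z := (Real.one_le_rpow (one_le_japanese z) hμ.le).trans (h₁ z)
  have hpos z : 0 < Λ z := pos_of_mul_pos_right (zero_lt_one.trans_le (hlow z)) hc₁.le
  refine ⟨hpos, c₁ + c₂, 1, fun z => ⟨?_, ?_⟩⟩ <;> rw [pow_one]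
  · calc Λ z ≤ c₂ * (1 + ‖z‖) :=
          (h₂ z).trans (mul_le_mul_of_nonneg_left (japanese_le_one_add_norm z) hc₂.le)
      _ ≤ (c₁ + c₂) * (1 + ‖z‖) := by gcongr; linarith
  · calc (Λ z)⁻¹ ≤ c₁ := (inv_le_iff_one_le_mul₀ (hpos z)).2 (hlow z)
      _ ≤ c₁ + c₂ := by linarith
      _ ≤ (c₁ + c₂) * (1 + ‖z‖) :=
        le_mul_of_one_le_right (by positivity) (le_add_of_nonneg_right (norm_nonneg z))

theorem IsTempered.amplitudeWeight_le (hΛ : IsTempered Λ) {ρ : ℝ} (hρ : 0 ≤ ρ) (m m' : ℝ) :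
    ∃ (c : ℝ) (r : ℕ), ∀ (k : ℕ) (x y ξ : Rn n),
      amplitudeWeight Λ ρ m m' k x y ξ ≤ c * (1 + ‖(x, y, ξ)‖) ^ r := by
  obtain ⟨c₁, r₁, hc₁, h₁⟩ := hΛ.exists_rpow_le m
  obtain ⟨c₂, r₂, hc₂, h₂⟩ := (isTempered_japanese (V := Rn n)).exists_rpow_le m'
  refine ⟨c₁ * 2 ^ r₁ * (c₂ * 2 ^ r₂), r₁ + r₂, fun k x y ξ => ?_⟩
  set p := (x, y, ξ)
  set z : R2n n := WithLp.toLp 2 (x, ξ)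
  have hx : ‖x‖ ≤ ‖p‖ := norm_fst_le p
  have hy : ‖y‖ ≤ ‖p‖ := (norm_fst_le p.2).trans (norm_snd_le p)
  have hξ : ‖ξ‖ ≤ ‖p‖ := (norm_snd_le p.2).trans (norm_snd_le p)
  have hz : 1 + ‖z‖ ≤ 2 * (1 + ‖p‖) := by
    have : ‖z‖ ≤ ‖x‖ + ‖ξ‖ := by
      rw [WithLp.prod_norm_eq_of_L2]
      exact Real.sqrt_le_iff.2 ⟨by positivity, by
        change ‖x‖ ^ 2 + ‖ξ‖ ^ 2 ≤ _
        nlinarith [norm_nonneg x, norm_nonneg ξ]⟩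
    linarith
  have hxy : 1 + ‖x - y‖ ≤ 2 * (1 + ‖p‖) := by linarith [norm_sub_le x y]
  have hΛ0 : 0 < Λ z := hΛ.1 z
  have hj0 : 0 < japanese (x - y) := isTempered_japanese.1 _
  have hdecay : (1 + Λ z * japanese (x - y) ^ (-m')) ^ (-(ρ * k)) ≤ 1 :=
    Real.rpow_le_one_of_one_le_of_nonpos (le_add_of_nonneg_right (by positivity))
      (neg_nonpos.2 (by positivity))
  calc amplitudeWeight Λ ρ m m' k x y ξ ≤ Λ z ^ m * japanese (x - y) ^ m' :=
        mul_le_of_le_one_right (by positivity) hdecay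
    _ ≤ c₁ * (2 * (1 + ‖p‖)) ^ r₁ * (c₂ * (2 * (1 + ‖p‖)) ^ r₂) := by
        gcongr
        · exact (h₁ z).trans (by gcongr)
        · exact (h₂ (x - y)).trans (by gcongr)
    _ = _ := by rw [mul_pow, mul_pow, pow_add]; ring

variable {m ρ : ℝ} {a : Net (Rn n × Rn n × Rn n)}

theorem Amplitude.exists_derivBound (hΛ : IsTempered Λ) (hρ : 0 ≤ ρ) (ha : a ∈ Amplitude Λ m ρ) :
    ∃ r : ℕ, DerivBound moderate (fun p => (1 + ‖p‖) ^ r) a := by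
  obtain ⟨hs, m', h⟩ := ha
  obtain ⟨c, r, hw⟩ := hΛ.amplitudeWeight_le hρ m m'
  refine ⟨r, derivBound_of_partialD₃ hs fun α β γ => ?_⟩
  obtain ⟨N, d, hd, hb⟩ := h α β γ
  refine (weightedBound_moderate_iff fun p => by positivity).2 ⟨N, d * c, fun ε ⟨x, y, ξ⟩ => ?_⟩
  rw [← le_div_iff₀' (pow_pos ε.2.1 N), div_eq_mul_inv, mul_assoc d]
  exact (hb ε x y ξ).trans (mul_le_mul_of_nonneg_right
    (mul_le_mul_of_nonneg_left (hw _ x y ξ) hd.le) (inv_nonneg.2 (pow_nonneg ε.2.1.le N)))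

theorem NegligibleAmplitude.exists_derivBound (hΛ : IsTempered Λ) (hρ : 0 ≤ ρ)
    (ha : a ∈ NegligibleAmplitude Λ m ρ) :
    ∃ r : ℕ, DerivBound negligible (fun p => (1 + ‖p‖) ^ r) a := by
  obtain ⟨⟨hs, -⟩, m', h⟩ := ha
  obtain ⟨c, r, hw⟩ := hΛ.amplitudeWeight_le hρ m m'
  refine ⟨r, derivBound_of_partialD₃ hs fun α β γ => ?_⟩
  refine (weightedBound_negligible_iff fun p => by positivity).2 fun q => ?_
  obtain ⟨d, hd, hb⟩ := h α β γ q
  refine ⟨d * c, fun ε ⟨x, y, ξ⟩ => ?_⟩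
  rw [inv_mul_le_iff₀' (pow_pos ε.2.1 q), mul_assoc d]
  exact (hb ε x y ξ).trans (mul_le_mul_of_nonneg_right
    (mul_le_mul_of_nonneg_left (hw _ x y ξ) hd.le) (pow_nonneg ε.2.1.le q))

end Tempered

section PolyBound

variable {ι E F G H : Type*} [NormedAddCommGroup E] [NormedSpace ℝ E]
  [NormedAddCommGroup F] [NormedSpace ℝ F] [NormedAddCommGroup G] [NormedSpace ℝ G]
  [NormedAddCommGroup H] [NormedSpace ℝ H] {T T₁ T₂ : Submodule ℝ (ι → ℝ)} {W : E → ℝ}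

/-- A family of smooth functions each of whose derivatives grows at most polynomially, up to
factors in `T`; the degree may depend on the order of the derivative. -/
def PolyBound (T : Submodule ℝ (ι → ℝ)) (u : ι → E → F) : Prop :=
  (∀ i, ContDiff ℝ ∞ (u i)) ∧ ∀ k : ℕ, ∃ N : ℕ,
    WeightedBound T (fun x => (1 + ‖x‖) ^ N) fun i x => ‖iteratedFDeriv ℝ k (u i) x‖

theorem PolyBound.bilinear_rapidDecay {u : ι → E → F} {v : ι → E → G} (hu : PolyBound T₁ u)
    (hv : RapidDecay T₂ W id v) (B : F →L[ℝ] G →L[ℝ] H) :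
    RapidDecay (T₁ * T₂) W id fun i x => B (u i x) (v i x) := by
  choose hu N hN using hu
  refine fun K => ⟨fun i => B.isBoundedBilinearMap.contDiff.comp ((hu i).prodMk (hv.contDiff i)),
    fun k => .mono (.const_mul (.sum fun j _ => ?_) (norm_nonneg B)) fun i x =>
      B.norm_iteratedFDeriv_le_of_bilinear (hu i) (hv.contDiff i) x (by exact_mod_cast le_top)⟩
  convert (((hN j).const_mul (Nat.cast_nonneg (k.choose j))).mul ((hv (K + N j)).2 (k - j))
    (fun _ _ => by positivity) fun _ _ => norm_nonneg _) using 2 with x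
  have : (1 + ‖x‖) ^ N j ≠ 0 := by positivity
  rw [id, pow_add]
  field_simp

theorem polyBound_of_partialD {n : ℕ} {u : ι → Rn n → ℂ} (hu : ∀ i, ContDiff ℝ ∞ (u i))
    (h : ∀ α : Fin n → ℕ, ∃ N : ℕ,
      WeightedBound T (fun x => (1 + ‖x‖) ^ N) fun i x => ‖partialD α (u i) x‖) :
    PolyBound T u := by
  choose N hN using h
  refine ⟨hu, fun k => ?_⟩
  choose α hα using exists_partialD_eq (n := n) (k := k)
  refine ⟨∑ s, N (α s), weightedBound_iteratedFDeriv_of_basis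
    (EuclideanSpace.basisFun (Fin n) ℝ).toBasis fun s => ?_⟩
  simp only [hα s _ (hu _)]
  refine (hN (α s)).mono_weight zero_le_one fun x => ?_
  rw [one_mul]
  exact pow_le_pow_right₀ (le_add_of_nonneg_right (norm_nonneg x))
    (Finset.single_le_sum (f := fun s => N (α s)) (fun _ _ => Nat.zero_le _) (Finset.mem_univ s))

end PolyBound

section Nets

variable {n : ℕ} {u : Net (Rn n)}

theorem ETau.polyBound (hu : u ∈ ETau n) : PolyBound moderate u := by
  refine polyBound_of_partialD hu.1 fun α => ?_
  obtain ⟨N, C, h⟩ := hu.2 α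
  refine ⟨N, (weightedBound_moderate_iff fun x => by positivity).2 ⟨N, |C|, fun ε x => ?_⟩⟩
  have hj : 0 < japanese x := isTempered_japanese.1 x
  have hC := h ε x
  rw [mul_left_comm, inv_mul_le_iff₀' (by positivity)] at hC
  exact hC.trans (mul_le_mul (le_abs_self C)
    (pow_le_pow_left₀ hj.le (japanese_le_one_add_norm x) N) (by positivity) (abs_nonneg C))

theorem NS.polyBound (hu : u ∈ NS n) : PolyBound negligible u := by
  refine polyBound_of_partialD hu.1 fun α =>
    ⟨0, (weightedBound_negligible_iff fun x => by positivity).2 fun q => ?_⟩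
  obtain ⟨C, h⟩ := hu.2 0 α q
  exact ⟨C, fun ε x => by simpa [monomial] using h ε x⟩

theorem mem_ETau_of_derivBound (hu : DerivBound moderate (fun _ => 1) u) : u ∈ ETau n := by
  refine ⟨hu.1, fun α => ?_⟩
  obtain ⟨N, c, h⟩ := (weightedBound_moderate_iff fun _ => zero_le_one).1 (hu.2 (order α))
  refine ⟨N, c, fun ε x => ?_⟩
  have hj : (japanese x ^ N)⁻¹ ≤ 1 := inv_le_one_of_one_le₀ (one_le_pow₀ (one_le_japanese x))
  calc (ε : ℝ) ^ N * ((japanese x ^ N)⁻¹ * ‖partialD α (u ε) x‖)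
      ≤ (ε : ℝ) ^ N * ‖iteratedFDeriv ℝ (order α) (u ε) x‖ :=
        mul_le_mul_of_nonneg_left ((mul_le_of_le_one_left (norm_nonneg _) hj).trans
          (norm_partialD_le α (u ε) x)) (pow_nonneg ε.2.1.le N)
    _ ≤ c := (h ε x).trans_eq (mul_one c)

theorem abs_monomial_le (α : Fin n → ℕ) (x : Rn n) : |monomial α x| ≤ (1 + ‖x‖) ^ order α := by
  rw [monomial, Finset.abs_prod, order, ← Finset.prod_pow_eq_pow_sum]
  refine Finset.prod_le_prod (fun _ _ => abs_nonneg _) fun i _ => ?_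
  rw [abs_pow]
  have : |x i| ≤ ‖x‖ := PiLp.norm_apply_le x i
  exact pow_le_pow_left₀ (abs_nonneg _) (by linarith) _

theorem mem_NS_of_rapidDecay (hu : RapidDecay negligible (fun _ => 1) id u) : u ∈ NS n := by
  refine ⟨hu.contDiff, fun α β q => ?_⟩
  obtain ⟨c, h⟩ := (weightedBound_negligible_iff fun x => by positivity).1
    ((hu (order α)).2 (order β)) q
  refine ⟨c, fun ε x => ?_⟩
  rw [norm_mul, Complex.norm_real, Real.norm_eq_abs, mul_left_comm]
  have hε := inv_nonneg.2 (pow_nonneg ε.2.1.le q)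
  calc |monomial α x| * (((ε : ℝ) ^ q)⁻¹ * ‖partialD β (u ε) x‖)
      ≤ (1 + ‖x‖) ^ order α * (c * (1 * ((1 + ‖x‖) ^ order α)⁻¹)) :=
        mul_le_mul (abs_monomial_le α x)
          ((mul_le_mul_of_nonneg_left (norm_partialD_le β (u ε) x) hε).trans (h ε x))
          (mul_nonneg hε (norm_nonneg _)) (by positivity)
    _ = c := by field_simp

end Nets

section Dilation

variable {V : Type*} [NormedAddCommGroup V] [NormedSpace ℝ V]

theorem exists_norm_iteratedFDeriv_dilate_le (ψ : SchwartzMap V ℂ) (k K : ℕ) :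
    ∃ C : ℝ, 0 ≤ C ∧ ∀ (t : Param) (y : V),
      ‖iteratedFDeriv ℝ k (fun y => ψ ((t : ℝ) • y)) y‖ ≤
        C * ((t : ℝ) ^ K)⁻¹ * ((1 + ‖y‖) ^ K)⁻¹ := by
  have hψ := SchwartzMap.one_add_le_sup_seminorm_apply (𝕜 := ℝ) (m := (K, k)) le_rfl le_rfl ψ
  set C : ℝ := _
  replace hψ : ∀ x, (1 + ‖x‖) ^ K * ‖iteratedFDeriv ℝ k ψ x‖ ≤ C := hψ
  refine ⟨C, le_trans (by positivity) (hψ 0), fun ⟨t, ht0, ht1⟩ y => ?_⟩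
  have hL : ‖t • ContinuousLinearMap.id ℝ V‖ ≤ 1 := by
    rw [norm_smul, Real.norm_of_nonneg ht0.le]
    exact mul_le_one₀ ht1 (norm_nonneg _) ContinuousLinearMap.norm_id_le
  have hchain := norm_iteratedFDeriv_comp_clm_le (ψ.smooth ⊤) (t • ContinuousLinearMap.id ℝ V) k y
  have hscale : t * (1 + ‖y‖) ≤ 1 + ‖t • y‖ := by
    rw [norm_smul, Real.norm_of_nonneg ht0.le]; linarith
  rw [mul_assoc, ← mul_inv, ← mul_pow, ← div_eq_mul_inv, le_div_iff₀' (by positivity)]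
  calc _ ≤ (1 + ‖t • y‖) ^ K * ‖iteratedFDeriv ℝ k ψ (t • y)‖ :=
        mul_le_mul (pow_le_pow_left₀ (by positivity) hscale K)
          (hchain.trans (mul_le_of_le_one_left (norm_nonneg _) (pow_le_one₀ (norm_nonneg _) hL)))
          (norm_nonneg _) (by positivity)
    _ ≤ C := hψ (t • y)

theorem rapidDecay_dilate (ψ : SchwartzMap V ℂ) :
    RapidDecay moderate (fun _ => 1) id fun (ε : Param) y => ψ ((ε : ℝ) • y) := fun K =>
  ⟨fun _ => (ψ.smooth ⊤).comp (contDiff_const_smul _), fun k =>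
    let ⟨C, hC0, hC⟩ := exists_norm_iteratedFDeriv_dilate_le ψ k K
    ⟨fun ε => C * ((ε : ℝ) ^ K)⁻¹, ⟨K, isBigO_const_mul_self _ _ _⟩,
      fun ε => mul_nonneg hC0 (inv_nonneg.2 (pow_nonneg ε.2.1.le K)), by simpa using hC⟩⟩

theorem derivBound_one_dilate (ψ : SchwartzMap V ℂ) :
    DerivBound 1 (fun _ => 1) fun (h : Param) z => ψ ((h : ℝ) • z) :=
  ⟨fun _ => (ψ.smooth ⊤).comp (contDiff_const_smul _), fun k =>
    let ⟨_, hC0, hC⟩ := exists_norm_iteratedFDeriv_dilate_le ψ k 0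
    weightedBound_one hC0 (by simpa using hC)⟩

end Dilation

section Regularization

variable {n : ℕ}

theorem hat_scaled (φ : SchwartzMap (Rn n) ℂ) (ε : Param) (y : Rn n) :
    hat (scaled φ ε) y = hat φ ((ε : ℝ) • y) := by
  have hε : (0 : ℝ) < ε := ε.2.1
  have h := Measure.integral_comp_inv_smul_of_nonneg (volume : Measure (Rn n))
    (fun x => Complex.exp (-Complex.I * (inner ℝ x ((ε : ℝ) • y) : ℝ)) * φ x) hε.le
  rw [finrank_euclideanSpace_fin] at h
  calc hat (scaled φ ε) y = (((ε : ℝ) ^ n)⁻¹ : ℝ) * ∫ x, Complex.exp (-Complex.I *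
        (inner ℝ ((ε : ℝ)⁻¹ • x) ((ε : ℝ) • y) : ℝ)) * φ ((ε : ℝ)⁻¹ • x) := by
        rw [hat, ← integral_const_mul]
        congr with x
        rw [scaled, real_inner_smul_left, real_inner_smul_right, inv_mul_cancel_left₀ hε.ne']
        ring
    _ = hat φ ((ε : ℝ) • y) := by
        rw [h, Complex.real_smul, ← mul_assoc, ← Complex.ofReal_mul,
          inv_mul_cancel₀ (by positivity), Complex.ofReal_one, one_mul, hat]

theorem exists_schwartzMap_eq_hat (φ : SchwartzMap (Rn n) ℂ) :
    ∃ ψ : SchwartzMap (Rn n) ℂ, ∀ y, hat φ y = ψ y := by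
  have hπ : (2 * Real.pi)⁻¹ ≠ 0 := by positivity
  refine ⟨SchwartzMap.compCLMOfContinuousLinearEquiv ℂ
    (ContinuousLinearEquiv.smulLeft (Units.mk0 _ hπ)) (𝓕 φ), fun y => ?_⟩
  calc hat φ y = ∫ v, Complex.exp (Complex.I * (⟪-y, v⟫ : ℝ)) • φ v := by
        rw [hat]
        congr with v
        rw [inner_neg_left, real_inner_comm]
        push_cast
        rw [smul_eq_mul, neg_mul, mul_neg]
    _ = 𝓕 φ ((2 * Real.pi)⁻¹ • y) := by
        rw [integral_exp_inner_smul_eq_fourier, neg_smul_neg, SchwartzMap.fourier_coe]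

theorem rapidDecay_hat_scaled (φ : SchwartzMap (Rn n) ℂ) :
    RapidDecay moderate (fun _ => 1) id fun ε => hat (scaled φ ε) := by
  obtain ⟨ψ, hψ⟩ := exists_schwartzMap_eq_hat φ
  convert rapidDecay_dilate ψ using 2 with ε
  ext y
  rw [hat_scaled, hψ]

end Regularization

section OscillatoryIntegral

section Uniqueness

variable {V : Type} [NormedAddCommGroup V] [NormedSpace ℝ V] [MeasureSpace V] {θ : V → ℝ}
  {b b' : V → ℂ} {I J : ℂ}

theorem exists_schwartzMap_apply_zero_eq_one (V : Type*) [NormedAddCommGroup V] [NormedSpace ℝ V]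
    [FiniteDimensional ℝ V] : ∃ ψ : SchwartzMap V ℂ, ψ 0 = 1 := by
  let f : ContDiffBump (0 : V) := ⟨1, 2, zero_lt_one, one_lt_two⟩
  have hsupp : HasCompactSupport fun x => (f x : ℂ) :=
    f.hasCompactSupport.comp_left Complex.ofReal_zero
  refine ⟨hsupp.toSchwartzMap (Complex.ofRealCLM.contDiff.comp f.contDiff), ?_⟩
  change ((f 0 : ℝ) : ℂ) = 1
  rw [f.one_of_mem_closedBall (Metric.mem_closedBall_self f.rIn_pos.le), Complex.ofReal_one]

theorem IsOscIntegral.unique [FiniteDimensional ℝ V] (h : IsOscIntegral θ b I)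
    (h' : IsOscIntegral θ b J) : I = J :=
  let ⟨ψ, hψ⟩ := exists_schwartzMap_apply_zero_eq_one V
  tendsto_nhds_unique (h ψ hψ).2 (h' ψ hψ).2

theorem isOscIntegral_oscIntegral (h : ∃ I, IsOscIntegral θ b I) :
    IsOscIntegral θ b (oscIntegral θ b) := by
  rw [oscIntegral, dif_pos h]
  exact h.choose_spec

theorem IsOscIntegral.oscIntegral_eq [FiniteDimensional ℝ V] (h : IsOscIntegral θ b I) :
    oscIntegral θ b = I :=
  (isOscIntegral_oscIntegral ⟨I, h⟩).unique h

theorem IsOscIntegral.add (hb : IsOscIntegral θ b I) (hb' : IsOscIntegral θ b' J) :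
    IsOscIntegral θ (fun z => b z + b' z) (I + J) := fun ψ hψ => by
  simp only [mul_add, add_mul]
  refine ⟨fun h hh => ((hb ψ hψ).1 h hh).add ((hb' ψ hψ).1 h hh),
    ((hb ψ hψ).2.add (hb' ψ hψ).2).congr' ?_⟩
  filter_upwards [self_mem_nhdsWithin] with h hh
  exact (integral_add ((hb ψ hψ).1 h hh) ((hb' ψ hψ).1 h hh)).symm

theorem IsOscIntegral.const_mul (hb : IsOscIntegral θ b I) (c : ℂ) :
    IsOscIntegral θ (fun z => c * b z) (c * I) := fun ψ hψ => by
  simp only [mul_left_comm _ c, mul_assoc c, integral_const_mul]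
  exact ⟨fun h hh => ((hb ψ hψ).1 h hh).const_mul c, (hb ψ hψ).2.const_mul c⟩

end Uniqueness

theorem integrable_mul_schwartzMap_smul {V : Type*} [NormedAddCommGroup V] [NormedSpace ℝ V]
    [FiniteDimensional ℝ V] [MeasurableSpace V] [BorelSpace V] {μ : Measure V}
    [μ.IsAddHaarMeasure] {f : V → ℂ} (hf : Continuous f) {C : ℝ} {r : ℕ}
    (hC : ∀ v, ‖f v‖ ≤ C * (1 + ‖v‖) ^ r) (ψ : SchwartzMap V ℂ) {h : ℝ} (hh : h ≠ 0) :
    Integrable (fun v => f v * ψ (h • v)) μ := by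
  let χ : SchwartzMap V ℂ := SchwartzMap.compCLMOfContinuousLinearEquiv ℂ
    (ContinuousLinearEquiv.smulLeft (Units.mk0 h hh)) ψ
  set N := Module.finrank ℝ V + 1
  have hχ := SchwartzMap.one_add_le_sup_seminorm_apply (𝕜 := ℝ) (m := (r + N, 0)) le_rfl le_rfl χ
  set D : ℝ := _
  replace hχ : ∀ v, (1 + ‖v‖) ^ (r + N) * ‖iteratedFDeriv ℝ 0 χ v‖ ≤ D := hχ
  refine integrable_of_norm_le_inv_pow (B := C * D) (hf.mul χ.continuous) fun v => ?_
  have hCv : 0 ≤ C * (1 + ‖v‖) ^ r := (norm_nonneg _).trans (hC v)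
  have hC0 : 0 ≤ C := nonneg_of_mul_nonneg_left hCv (by positivity)
  have hv := hχ v
  rw [norm_iteratedFDeriv_zero] at hv
  rw [norm_mul, ← div_eq_mul_inv, le_div_iff₀ (by positivity)]
  calc ‖f v‖ * ‖χ v‖ * (1 + ‖v‖) ^ N
      ≤ C * (1 + ‖v‖) ^ r * ‖χ v‖ * (1 + ‖v‖) ^ N := by gcongr; exact hC v
    _ = C * ((1 + ‖v‖) ^ (r + N) * ‖χ v‖) := by rw [pow_add]; ring
    _ ≤ C * D := mul_le_mul_of_nonneg_left hv hC0

section IteratedIntegral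

variable {n : ℕ} {ι : Type*} {T : Submodule ℝ (ι → ℝ)} {r : ℕ}
  {b : ι → (Rn n × Rn n) × Rn n → ℂ}

/-- The weight `(1 + |x|)^r (1 + |ξ|)^r`, which bounds the growth of amplitudes. -/
noncomputable def growthWeight (r : ℕ) (z : Rn n × Rn n) : ℝ := (1 + ‖z.1‖) ^ r * (1 + ‖z.2‖) ^ r

theorem continuous_growthWeight : Continuous (growthWeight r : Rn n × Rn n → ℝ) := by
  unfold growthWeight
  fun_prop

/-- The projection `(x, ξ) ↦ -ξ`, the frequency of the phase `-yξ` in `y`. -/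
noncomputable def negSnd (n : ℕ) : Rn n × Rn n →L[ℝ] Rn n := -ContinuousLinearMap.snd ℝ _ _

/-- The iterated integral `∫ e^{ixξ} ∫ e^{-iyξ} b((x, ξ), y) dy dξ`. -/
noncomputable def iteratedIntegral (b : (Rn n × Rn n) × Rn n → ℂ) : Rn n → ℂ :=
  partialFourier (ContinuousLinearMap.id ℝ (Rn n)) (partialFourier (negSnd n) b)

theorem RapidDecay.partialFourier_negSnd
    (hb : RapidDecay T (fun p => growthWeight r p.1) Prod.snd b) :
    RapidDecay T (fun z => (1 + ‖z.1‖) ^ r) Prod.snd fun i => partialFourier (negSnd n) (b i) := by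
  have h := hb.partialFourier continuous_growthWeight (negSnd n)
  refine RapidDecay.absorb (r := r) fun K => ?_
  simpa [growthWeight, negSnd] using h K

protected theorem RapidDecay.iteratedIntegral
    (hb : RapidDecay T (fun p => growthWeight r p.1) Prod.snd b) :
    RapidDecay T (fun _ => 1) id fun i => iteratedIntegral (b i) := by
  have h := hb.partialFourier_negSnd.partialFourier (w := fun x => (1 + ‖x‖) ^ r) (by fun_prop)
    (ContinuousLinearMap.id ℝ (Rn n))
  refine RapidDecay.absorb (r := r) fun K => ?_
  simpa [iteratedIntegral] using h K

/-- The amplitude `b((x, ξ), y)` multiplied by the cutoff `ψ(hy, hξ)`. -/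
noncomputable def cutoffAmplitude (b : (Rn n × Rn n) × Rn n → ℂ) (ψ : SchwartzMap (Rn n × Rn n) ℂ)
    (h : ℝ) (p : (Rn n × Rn n) × Rn n) : ℂ :=
  b p * ψ (h • (p.2, p.1.2))

protected theorem RapidDecay.cutoffAmplitude
    (hb : RapidDecay T (fun p => growthWeight r p.1) Prod.snd b)
    (ψ : SchwartzMap (Rn n × Rn n) ℂ) (i : ι) :
    RapidDecay (1 : Submodule ℝ (Param → ℝ)) (fun p => growthWeight r p.1) Prod.snd
      fun h : Param => cutoffAmplitude (b i) ψ h := by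
  have hψ := (derivBound_one_dilate ψ).comp_clm
    ((ContinuousLinearMap.snd ℝ (Rn n × Rn n) (Rn n)).prod
      ((ContinuousLinearMap.snd ℝ _ _).comp (ContinuousLinearMap.fst ℝ (Rn n × Rn n) (Rn n))))
  have hbψ := hψ.bilinear_rapidDecay (fun K => (hb K).const i) (ContinuousLinearMap.mul ℝ ℂ).flip
  simp only [one_mul] at hbψ
  exact hbψ

theorem norm_cutoffAmplitude_le (b : (Rn n × Rn n) × Rn n → ℂ)
    (ψ : SchwartzMap (Rn n × Rn n) ℂ) (h : ℝ) (p : (Rn n × Rn n) × Rn n) :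
    ‖cutoffAmplitude b ψ h p‖ ≤ SchwartzMap.seminorm ℝ 0 0 ψ * ‖b p‖ := by
  rw [cutoffAmplitude, norm_mul, mul_comm]
  exact mul_le_mul_of_nonneg_right (ψ.norm_le_seminorm ℝ _) (norm_nonneg _)

theorem exp_phase_mul_eq (b : (Rn n × Rn n) × Rn n → ℂ) (ψ : SchwartzMap (Rn n × Rn n) ℂ) (h : ℝ)
    (x : Rn n) (p : Rn n × Rn n) :
    Complex.exp (Complex.I * (phase p : ℝ)) *
        (Complex.exp (Complex.I * (⟪x, p.2⟫ : ℝ)) * b ((x, p.2), p.1)) * ψ (h • p) =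
      Complex.exp (Complex.I * (⟪x, p.2⟫ : ℝ)) *
        (Complex.exp (Complex.I * (⟪negSnd n (x, p.2), p.1⟫ : ℝ)) •
          cutoffAmplitude b ψ h ((x, p.2), p.1)) := by
  have hphase : phase p = ⟪negSnd n (x, p.2), p.1⟫ := by
    rw [phase, real_inner_comm, ← inner_neg_left]
    rfl
  rw [hphase, cutoffAmplitude, smul_eq_mul]
  ring

theorem RapidDecay.integrable_regularized
    (hb : RapidDecay T (fun p => growthWeight r p.1) Prod.snd b)
    (ψ : SchwartzMap (Rn n × Rn n) ℂ) (i : ι) (x : Rn n) {h : ℝ} (hh : 0 < h) :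
    Integrable fun p : Rn n × Rn n => Complex.exp (Complex.I * (phase p : ℝ)) *
      (Complex.exp (Complex.I * (⟪x, p.2⟫ : ℝ)) * b i ((x, p.2), p.1)) * ψ (h • p) := by
  obtain ⟨C, -, hC0, hC⟩ := hb.derivBound.norm
  have hbc := (hb.contDiff i).continuous
  have hphase : Continuous (phase : Rn n × Rn n → ℝ) := by unfold phase; fun_prop
  rw [Measure.volume_eq_prod]
  refine integrable_mul_schwartzMap_smul (C := C i * (1 + ‖x‖) ^ r) (r := r) (by fun_prop)
    (fun p => ?_) ψ hh.ne'
  rw [norm_mul, norm_mul, Complex.norm_exp_I_mul_ofReal, Complex.norm_exp_I_mul_ofReal, one_mul,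
    one_mul]
  calc ‖b i ((x, p.2), p.1)‖ ≤ C i * ((1 + ‖x‖) ^ r * (1 + ‖p.2‖) ^ r) := hC i ((x, p.2), p.1)
    _ ≤ C i * ((1 + ‖x‖) ^ r * (1 + ‖p‖) ^ r) := by
      have := hC0 i
      gcongr
      exact norm_snd_le p
    _ = C i * (1 + ‖x‖) ^ r * (1 + ‖p‖) ^ r := (mul_assoc ..).symm

theorem RapidDecay.integral_regularized
    (hb : RapidDecay T (fun p => growthWeight r p.1) Prod.snd b)
    (ψ : SchwartzMap (Rn n × Rn n) ℂ) (i : ι) (x : Rn n) {h : ℝ} (hh : 0 < h) :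
    ∫ p : Rn n × Rn n, Complex.exp (Complex.I * (phase p : ℝ)) *
        (Complex.exp (Complex.I * (⟪x, p.2⟫ : ℝ)) * b i ((x, p.2), p.1)) * ψ (h • p) =
      iteratedIntegral (cutoffAmplitude (b i) ψ h) x := by
  have hint := hb.integrable_regularized ψ i x hh
  simp only [exp_phase_mul_eq, Measure.volume_eq_prod] at hint ⊢
  rw [integral_prod_symm _ hint]
  simp only [integral_const_mul]
  rfl

theorem RapidDecay.tendsto_partialFourier_cutoffAmplitude
    (hb : RapidDecay T (fun p => growthWeight r p.1) Prod.snd b)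
    (ψ : SchwartzMap (Rn n × Rn n) ℂ) (hψ : ψ 0 = 1) (i : ι) (z : Rn n × Rn n) :
    Tendsto (fun h : ℝ => partialFourier (negSnd n)
      (cutoffAmplitude (b i) ψ h) z) (𝓝[>] 0)
      (𝓝 (partialFourier (negSnd n) (b i) z)) := by
  have hbc := (hb.contDiff i).continuous
  have hψc := ψ.continuous
  refine tendsto_integral_filter_of_dominated_convergence
    (fun v => SchwartzMap.seminorm ℝ 0 0 ψ *
      ‖Complex.exp (Complex.I * (⟪negSnd n z, v⟫ : ℝ)) • b i (z, v)‖)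
    (.of_forall fun h => Continuous.aestronglyMeasurable ?_)
    (.of_forall fun h => .of_forall fun v => ?_)
    ((hb.integrable_exp_smul (negSnd n) i z).norm.const_mul _) (.of_forall fun v => ?_)
  · unfold cutoffAmplitude
    fun_prop
  · simpa only [norm_exp_I_mul_ofReal_smul] using norm_cutoffAmplitude_le (b i) ψ h (z, v)
  · have hcont : Continuous fun h : ℝ => cutoffAmplitude (b i) ψ h (z, v) := by
      unfold cutoffAmplitude
      fun_prop
    have h0 : cutoffAmplitude (b i) ψ 0 (z, v) = b i (z, v) := by
      rw [cutoffAmplitude, zero_smul, hψ, mul_one]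
    exact ((hcont.tendsto' 0 _ h0).mono_left nhdsWithin_le_nhds).const_smul _

theorem RapidDecay.tendsto_iteratedIntegral_cutoffAmplitude
    (hb : RapidDecay T (fun p => growthWeight r p.1) Prod.snd b)
    (ψ : SchwartzMap (Rn n × Rn n) ℂ) (hψ : ψ 0 = 1) (i : ι) (x : Rn n) :
    Tendsto (fun h : ℝ => iteratedIntegral (cutoffAmplitude (b i) ψ h) x)
      (𝓝[>] 0) (𝓝 (iteratedIntegral (b i) x)) := by
  have hcut := (hb.cutoffAmplitude ψ i).partialFourier_negSnd
  obtain ⟨C, hC, -, hCb⟩ := (hcut (Module.finrank ℝ (Rn n) + 1)).norm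
  obtain ⟨c, rfl⟩ := Submodule.mem_one.1 hC
  have hev : ∀ᶠ h : ℝ in 𝓝[>] 0, h ∈ Set.Ioc (0 : ℝ) 1 := Ioc_mem_nhdsGT zero_lt_one
  refine tendsto_integral_filter_of_dominated_convergence
    (fun ξ => c * (1 + ‖x‖) ^ r * ((1 + ‖ξ‖) ^ (Module.finrank ℝ (Rn n) + 1))⁻¹)
    (hev.mono fun h hh => Continuous.aestronglyMeasurable ?_)
    (hev.mono fun h hh => .of_forall fun ξ => ?_)
    ((integrable_one_add_norm_pow_inv volume).const_mul _)
    (.of_forall fun ξ => (hb.tendsto_partialFourier_cutoffAmplitude ψ hψ i (x, ξ)).const_smul _)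
  · have := (hcut.contDiff ⟨h, hh⟩).continuous
    simp only at this
    fun_prop
  · rw [norm_exp_I_mul_ofReal_smul, mul_assoc]
    exact hCb ⟨h, hh⟩ (x, ξ)

theorem RapidDecay.isOscIntegral_iteratedIntegral
    (hb : RapidDecay T (fun p => growthWeight r p.1) Prod.snd b) (i : ι) (x : Rn n) :
    IsOscIntegral phase
      (fun p => Complex.exp (Complex.I * (⟪x, p.2⟫ : ℝ)) * b i ((x, p.2), p.1))
      (iteratedIntegral (b i) x) := fun ψ hψ =>
  ⟨fun _ hh => hb.integrable_regularized ψ i x hh,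
    (hb.tendsto_iteratedIntegral_cutoffAmplitude ψ hψ i x).congr'
      (eventually_mem_nhdsWithin.mono fun _ hh => (hb.integral_regularized ψ i x hh).symm)⟩

end IteratedIntegral

end OscillatoryIntegral

section Operator

variable {n : ℕ} {T₁ T₂ : Submodule ℝ (Param → ℝ)} {φ : SchwartzMap (Rn n) ℂ}
  {a : Net (Rn n × Rn n × Rn n)} {u v : Net (Rn n)} {r : ℕ}

/-- The permutation of the variables `((x, ξ), y) ↦ (x, y, ξ)`. -/
noncomputable def permuteVars (n : ℕ) : (Rn n × Rn n) × Rn n →L[ℝ] Rn n × Rn n × Rn n :=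
  ((ContinuousLinearMap.fst ℝ _ _).comp (ContinuousLinearMap.fst ℝ _ _)).prod
    ((ContinuousLinearMap.snd ℝ _ _).prod
      ((ContinuousLinearMap.snd ℝ _ _).comp (ContinuousLinearMap.fst ℝ _ _)))

theorem one_add_norm_permuteVars_le (p : (Rn n × Rn n) × Rn n) :
    1 + ‖permuteVars n p‖ ≤ (1 + ‖p.1.1‖) * (1 + ‖p.1.2‖) * (1 + ‖p.2‖) := by
  obtain ⟨⟨x, ξ⟩, y⟩ := p
  have hx := norm_nonneg x
  have hy := norm_nonneg y
  have hξ := norm_nonneg ξ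
  have hmax : ‖(x, y, ξ)‖ ≤ ‖x‖ + ‖ξ‖ + ‖y‖ :=
    max_le (by linarith) (max_le (by linarith) (by linarith))
  change 1 + ‖(x, y, ξ)‖ ≤ (1 + ‖x‖) * (1 + ‖ξ‖) * (1 + ‖y‖)
  nlinarith [mul_nonneg hx hξ, mul_nonneg hx hy, mul_nonneg hξ hy,
    mul_nonneg (mul_nonneg hx hξ) hy]

/-- The net `a_ε(x, y, ξ) u_ε(y) φ̂_ε(y)`, as functions of `((x, ξ), y)`: the variable of the inner
integral comes last. -/
noncomputable def fullAmplitude (φ : SchwartzMap (Rn n) ℂ) (a : Net (Rn n × Rn n × Rn n))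
    (u : Net (Rn n)) : Net ((Rn n × Rn n) × Rn n) :=
  fun ε p => a ε (permuteVars n p) * (u ε p.2 * hat (scaled φ ε) p.2)

theorem rapidDecay_fullAmplitude (φ : SchwartzMap (Rn n) ℂ)
    (ha : DerivBound T₁ (fun p => (1 + ‖p‖) ^ r) a) (hu : PolyBound T₂ u) :
    RapidDecay (T₁ * (T₂ * moderate)) (fun p => growthWeight r p.1) Prod.snd
      (fullAmplitude φ a u) := by
  have huφ := (hu.bilinear_rapidDecay (rapidDecay_hat_scaled φ)
    (ContinuousLinearMap.mul ℝ ℂ)).comp_clm (ContinuousLinearMap.snd ℝ (Rn n × Rn n) (Rn n))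
  have hauφ := (ha.comp_clm (permuteVars n)).bilinear_rapidDecay huφ (ContinuousLinearMap.mul ℝ ℂ)
  refine RapidDecay.absorb (r := r) (hauφ.mono_weight zero_le_one fun p => ?_)
  rw [one_mul, mul_one, growthWeight, ← mul_pow, ← mul_pow]
  exact pow_le_pow_left₀ (by positivity) (one_add_norm_permuteVars_le p) r

theorem isOscIntegral_integrand (φ : SchwartzMap (Rn n) ℂ)
    (ha : DerivBound T₁ (fun p => (1 + ‖p‖) ^ r) a) (hu : PolyBound T₂ u) (ε : Param) (x : Rn n) :
    IsOscIntegral phase (integrand φ a u ε x) (iteratedIntegral (fullAmplitude φ a u ε) x) := by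
  convert (rapidDecay_fullAmplitude φ ha hu).isOscIntegral_iteratedIntegral ε x using 2 with p
  rw [integrand, mul_assoc, mul_assoc]
  rfl

theorem rapidDecay_psiDO (φ : SchwartzMap (Rn n) ℂ)
    (ha : DerivBound T₁ (fun p => (1 + ‖p‖) ^ r) a) (hu : PolyBound T₂ u) :
    RapidDecay (T₁ * (T₂ * moderate)) (fun _ => 1) id (psiDO φ a u) := by
  convert (rapidDecay_fullAmplitude φ ha hu).iteratedIntegral.clm_comp
    (ContinuousLinearMap.mul ℝ ℂ (((2 * Real.pi) ^ n)⁻¹ : ℝ)) using 3 with ε x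
  exact congrArg _ (isOscIntegral_integrand φ ha hu ε x).oscIntegral_eq

theorem psiDO_add (hu : ∀ ε x, ∃ I, IsOscIntegral phase (integrand φ a u ε x) I)
    (hv : ∀ ε x, ∃ I, IsOscIntegral phase (integrand φ a v ε x) I) :
    psiDO φ a (u + v) = psiDO φ a u + psiDO φ a v := by
  ext ε x
  have hadd : integrand φ a (u + v) ε x =
      fun p => integrand φ a u ε x p + integrand φ a v ε x p := by
    ext p
    simp only [integrand, Pi.add_apply]
    ring
  have hosc := (isOscIntegral_oscIntegral (hu ε x)).add (isOscIntegral_oscIntegral (hv ε x))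
  simp only [psiDO, Pi.add_apply]
  rw [hadd, hosc.oscIntegral_eq, mul_add]

theorem psiDO_smul (c : ℂ) (hu : ∀ ε x, ∃ I, IsOscIntegral phase (integrand φ a u ε x) I) :
    psiDO φ a (c • u) = c • psiDO φ a u := by
  ext ε x
  have hsmul : integrand φ a (c • u) ε x = fun p => c * integrand φ a u ε x p := by
    ext p
    simp only [integrand, Pi.smul_apply, smul_eq_mul]
    ring
  have hosc := (isOscIntegral_oscIntegral (hu ε x)).const_mul c
  simp only [psiDO, Pi.smul_apply, smul_eq_mul]
  rw [hsmul, hosc.oscIntegral_eq, mul_left_comm]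

theorem existsUnique_linearMap_psiDO
    (hosc : ∀ u ∈ ETau n, ∀ ε x, ∃ I, IsOscIntegral phase (integrand φ a u ε x) I)
    (hE : ∀ u ∈ ETau n, psiDO φ a u ∈ ETau n) (hN : ∀ u ∈ NS n, psiDO φ a u ∈ NS n) :
    ∃! A : GTauS n →ₗ[ℂ] GTauS n, ∀ u : ETau n,
      ∃ h : psiDO φ a (u : Net (Rn n)) ∈ ETau n,
        A (GTauS.mk u) = GTauS.mk ⟨psiDO φ a (u : Net (Rn n)), h⟩ := by
  let Φ : ETau n →ₗ[ℂ] ETau n :=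
    { toFun := fun u => ⟨psiDO φ a u, hE u u.2⟩
      map_add' := fun u v => Subtype.ext (psiDO_add (hosc u u.2) (hosc v v.2))
      map_smul' := fun c u => Subtype.ext (psiDO_smul c (hosc u u.2)) }
  refine ⟨Submodule.mapQ _ _ Φ fun u hu => hN u hu, fun u => ⟨hE u u.2, rfl⟩, fun B hB => ?_⟩
  refine Submodule.linearMap_qext _ (LinearMap.ext fun u => ?_)
  obtain ⟨_, hBu⟩ := hB u
  exact hBu

end Operator

theorem theorem5p1_general (n : ℕ) (φ : SchwartzMap (Rn n) ℂ) (Λ : R2n n → ℝ)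
    (hΛ : IsTempered Λ) (m ρ : ℝ) (hρ : 0 ≤ ρ) (a : Net (Rn n × Rn n × Rn n))
    (ha : a ∈ Amplitude Λ m ρ) :
    (∀ u ∈ ETau n, ∀ (ε : Param) (x : Rn n),
      ∃ I : ℂ, IsOscIntegral phase (integrand φ a u ε x) I) ∧
    (∀ u ∈ ETau n, psiDO φ a u ∈ ETau n) ∧
    (∀ u ∈ NS n, psiDO φ a u ∈ NS n) ∧
    (a ∈ NegligibleAmplitude Λ m ρ → ∀ u ∈ ETau n, psiDO φ a u ∈ NS n) ∧
    (∃! A : GTauS n →ₗ[ℂ] GTauS n, ∀ u : ETau n,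
      ∃ h : psiDO φ a (u : Net (Rn n)) ∈ ETau n,
        A (GTauS.mk u) = GTauS.mk ⟨psiDO φ a (u : Net (Rn n)), h⟩) := by
  have hmoderate : moderate * (moderate * moderate) ≤ moderate :=
    (mul_le_mul' le_rfl moderate_mul_moderate_le).trans moderate_mul_moderate_le
  have hu_negligible : moderate * (negligible * moderate) ≤ negligible := by
    rw [mul_comm negligible]
    exact (mul_le_mul' le_rfl moderate_mul_negligible_le).trans moderate_mul_negligible_le
  have ha_negligible : negligible * (moderate * moderate) ≤ negligible := by
    rw [← mul_assoc, mul_comm, mul_comm negligible]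
    exact (mul_le_mul' le_rfl moderate_mul_negligible_le).trans moderate_mul_negligible_le
  obtain ⟨r, har⟩ := Amplitude.exists_derivBound hΛ hρ ha
  have hosc : ∀ u ∈ ETau n, ∀ ε x, ∃ I, IsOscIntegral phase (integrand φ a u ε x) I :=
    fun u hu ε x => ⟨_, isOscIntegral_integrand φ har (ETau.polyBound hu) ε x⟩
  have hE : ∀ u ∈ ETau n, psiDO φ a u ∈ ETau n := fun u hu =>
    mem_ETau_of_derivBound
      (((rapidDecay_psiDO φ har (ETau.polyBound hu)).mono_space hmoderate).derivBound)
  have hN : ∀ u ∈ NS n, psiDO φ a u ∈ NS n := fun u hu =>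
    mem_NS_of_rapidDecay ((rapidDecay_psiDO φ har (NS.polyBound hu)).mono_space hu_negligible)
  refine ⟨hosc, hE, hN, fun han u hu => ?_, existsUnique_linearMap_psiDO hosc hE hN⟩
  obtain ⟨r', han⟩ := NegligibleAmplitude.exists_derivBound hΛ hρ han
  exact mem_NS_of_rapidDecay
    ((rapidDecay_psiDO φ han (ETau.polyBound hu)).mono_space ha_negligible)

end Colombeau

theorem theorem5p1 (n : ℕ) (φ : SchwartzMap (Rn n) ℂ) (hφ : IsMollifier φ)
    (Λ : R2n n → ℝ) (hΛ : IsWeight Λ) (m ρ : ℝ) (hρ : ρ ∈ Set.Ioc (0 : ℝ) 1)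
    (a : Net (Rn n × Rn n × Rn n)) (ha : a ∈ Amplitude Λ m ρ) :
    (∀ u ∈ ETau n, ∀ (ε : Param) (x : Rn n),
      ∃ I : ℂ, IsOscIntegral phase (integrand φ a u ε x) I) ∧
    (∀ u ∈ ETau n, psiDO φ a u ∈ ETau n) ∧
    (∀ u ∈ NS n, psiDO φ a u ∈ NS n) ∧
    (a ∈ NegligibleAmplitude Λ m ρ → ∀ u ∈ ETau n, psiDO φ a u ∈ NS n) ∧
    (∃! A : GTauS n →ₗ[ℂ] GTauS n, ∀ u : ETau n,
      ∃ h : psiDO φ a (u : Net (Rn n)) ∈ ETau n,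
        A (GTauS.mk u) = GTauS.mk ⟨psiDO φ a (u : Net (Rn n)), h⟩) :=
  theorem5p1_general n φ Λ hΛ.isTempered m ρ hρ.1.le a ha
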